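/- Let $n\in\mathbb N$, $p\in(\tfrac73,\tfrac83)$ and $s:=\tfrac32p-3\in(\tfrac12,1)$. For a $1$-periodic function $f\in L^2(\mathbb R/\mathbb Z,\mathbb R^n)$ put $$[f]_{s,2}:=\Big(\int_{\mathbb R/\mathbb Z}\int_{-1/2}^{1/2}\frac{|f(u+w)-f(u)|^2}{|w|^{1+2s}}\,dw\,du\Big)^{1/2},$$ and let $W^{\frac32p-2,2}(\mathbb R/\mathbb Z,\mathbb R^n)=W^{1+s,2}(\mathbb R/\mathbb Z,\mathbb R^n)$ be the space of $1$-periodic functions $f\in L^2(\mathbb R/\mathbb Z,\mathbb R^n)$ with a weak derivative $f'\in L^2(\mathbb R/\mathbb Z,\mathbb R^n)$ such that $[f']_{s,2}<\infty$; its elements are identified with their continuous (in fact $C^1$) representatives. Let $W^{\frac32p-2,2}_{\mathrm{ir}}(\mathbb R/\mathbb Z,\mathbb R^n)$ be the set of those $\gamma$ in this space that are injective on $[0,1)$ and satisfy $|\gamma'|>0$ everywhere. For such $\gamma$ let $$\mathrm{BiLip}(\gamma):=\inf_{u_1\ne u_2\in\mathbb R/\mathbb Z}\frac{|\gamma(u_1)-\gamma(u_2)|}{|u_1-u_2|_{\mathbb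 R/\mathbb Z}},\qquad |w|_{\mathbb R/\mathbb Z}:=\min_{k\in\mathbb Z}|w+k|.$$ The generalized integral Menger curvature of $\gamma$ is $$\mathcal M^{(p,2)}(\gamma):=\iiint_{(\mathbb R/\mathbb Z)^3}\frac{|(\gamma(u_2)-\gamma(u_1))\wedge(\gamma(u_3)-\gamma(u_1))|^2}{\big(|\gamma(u_2)-\gamma(u_1)|\,|\gamma(u_3)-\gamma(u_1)|\,|\gamma(u_2)-\gamma(u_3)|\big)^p}\,|\gamma'(u_1)||\gamma'(u_2)||\gamma'(u_3)|\,du_1du_2du_3 ,$$ where $|a\wedge b|$ is the Euclidean norm of the exterior product. Its first and second variations are $$\delta\mathcal M^{(p,2)}(\gamma,h):=\tfrac{d}{d\tau}\Big|_{\tau=0}\mathcal M^{(p,2)}(\gamma+\tau h),\qquad \delta^2\mathcal M^{(p,2)}(\gamma)[h,g]:=\tfrac{d}{d\tau}\Big|_{\tau=0}\delta\mathcal M^{(p,2)}(\gamma+\tau g,h),$$ which are said to exist if the values (for all sufficiently small $|\tau|$) on the right-hand sides are finite, respectively exist, and the derivatives exist. Then there are functions $C_1,C_2:(0,\infty)\times[0,\infty)\to\mathbb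 R$, depending only on $n$ and $p$, each non-increasing in its first and non-decreasing in its second argument, such that for every $\gamma\in W^{\frac32p-2,2}_{\mathrm{ir}}(\mathbb R/\mathbb Z,\mathbb R^n)$ and all $h,g\in W^{\frac32p-2,2}(\mathbb R/\mathbb Z,\mathbb R^n)$ the first variation $\delta\mathcal M^{(p,2)}(\gamma,h)$ and the second variation $\delta^2\mathcal M^{(p,2)}(\gamma)[h,g]$ exist and satisfy $$|\delta\mathcal M^{(p,2)}(\gamma,h)|\le C_1\,[h']_{s,2},\qquad |\delta^2\mathcal M^{(p,2)}(\gamma)[h,g]|\le C_2\,[h']_{s,2}\,[g']_{s,2},$$ where $C_i=C_i\big(\mathrm{BiLip}(\gamma),[\gamma']_{s,2}\big)$ for $i=1,2$. -/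

import Mathlib

open MeasureTheory Filter Topology Set
open scoped ENNReal ContDiff

namespace Menger

/-- `g` is the weak derivative of `f` on the real line. -/
def HasWeakDeriv {E : Type*} [NormedAddCommGroup E] [NormedSpace ℝ E] (f g : ℝ → E) : Prop :=
  LocallyIntegrable f ∧ LocallyIntegrable g ∧
    ∀ φ : ℝ → ℝ, ContDiff ℝ ∞ φ → HasCompactSupport φ →
      ∫ x, deriv φ x • f x = -∫ x, φ x • g x

/-- The Sobolev-Slobodeckij seminorm `[f]_{s,2}` of a `1`-periodic function, with values
in `[0,∞]`. -/
noncomputable def slobodeckij {E : Type*} [NormedAddCommGroup E] (s : ℝ) (f : ℝ → E) : ℝ≥0∞ :=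
  (∫⁻ u in Ioc (0 : ℝ) 1, ∫⁻ w in Ioo (-(1 / 2) : ℝ) (1 / 2),
    ENNReal.ofReal (‖f (u + w) - f u‖ ^ 2 / |w| ^ (1 + 2 * s))) ^ (1 / 2 : ℝ)

/-- The seminorm `[f]_{s,2}` as a real number, to be used where it is finite. -/
noncomputable def slobodeckijReal {E : Type*} [NormedAddCommGroup E] (s : ℝ) (f : ℝ → E) : ℝ :=
  (slobodeckij s f).toReal

/-- `f` is (the continuous representative of) a function in the periodic Sobolev-Slobodeckij space
`W^{1+s,2}(ℝ/ℤ, E)`: it has a weak derivative `g` in `L²(ℝ/ℤ, E)` with `[g]_{s,2} < ∞`.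
For such `f` the weak derivative agrees almost everywhere with the classical `deriv f`. -/
def MemW {E : Type*} [NormedAddCommGroup E] [NormedSpace ℝ E] (s : ℝ) (f : ℝ → E) : Prop :=
  Function.Periodic f 1 ∧ Continuous f ∧
    ∃ g : ℝ → E, Function.Periodic g 1 ∧ HasWeakDeriv f g ∧
      MemLp g 2 (volume.restrict (Ioc (0 : ℝ) 1)) ∧ slobodeckij s g ≠ ⊤

/-- The injective regular curves in `W^{1+s,2}(ℝ/ℤ, E)`. -/
def MemWir {E : Type*} [NormedAddCommGroup E] [NormedSpace ℝ E] (s : ℝ) (γ : ℝ → E) : Prop :=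
  MemW s γ ∧ InjOn γ (Ico (0 : ℝ) 1) ∧ ∀ u, deriv γ u ≠ 0

/-- The bilipschitz constant of a `1`-periodic curve: the infimum of
`|γ(u₁) - γ(u₂)| / |u₁ - u₂|_{ℝ/ℤ}` over all `u₁ ≠ u₂` in `ℝ/ℤ`. -/
noncomputable def biLip {E : Type*} [NormedAddCommGroup E] (γ : ℝ → E) : ℝ :=
  sInf {r : ℝ | ∃ u₁ u₂ : ℝ, (u₁ : UnitAddCircle) ≠ (u₂ : UnitAddCircle) ∧
    r = ‖γ u₁ - γ u₂‖ / ‖((u₁ - u₂ : ℝ) : UnitAddCircle)‖}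

/-- The exterior product `a ∧ b`, given by its coordinates in the orthonormal basis
`e_i ∧ e_j`, `i < j`, of the second exterior power of `ℝⁿ`. -/
noncomputable def wedge {n : ℕ} (a b : EuclideanSpace ℝ (Fin n)) :
    EuclideanSpace ℝ {ij : Fin n × Fin n // ij.1 < ij.2} :=
  WithLp.toLp 2 fun ij => a ij.1.1 * b ij.1.2 - a ij.1.2 * b ij.1.1

/-- The inverse `1 / R^{(p,q)}(x,y,z)` of the generalized circumcircle diameter
`R^{(p,q)}(x,y,z) = (|y - x| |z - x| |y - z|)^p / |(y - x) ∧ (z - x)|^q`. -/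
noncomputable def invR {n : ℕ} (p q : ℝ) (x y z : EuclideanSpace ℝ (Fin n)) : ℝ :=
  ‖wedge (y - x) (z - x)‖ ^ q / (‖y - x‖ * ‖z - x‖ * ‖y - z‖) ^ p

/-- The generalized integral Menger curvature `M^{(p,q)}`, with values in `[0,∞]`. -/
noncomputable def menger {n : ℕ} (p q : ℝ) (γ : ℝ → EuclideanSpace ℝ (Fin n)) : ℝ≥0∞ :=
  ∫⁻ u : ℝ × ℝ × ℝ in Ioc (0 : ℝ) 1 ×ˢ Ioc (0 : ℝ) 1 ×ˢ Ioc (0 : ℝ) 1,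
    ENNReal.ofReal (‖deriv γ u.1‖ * ‖deriv γ u.2.1‖ * ‖deriv γ u.2.2‖ *
      invR p q (γ u.1) (γ u.2.1) (γ u.2.2))

/-- The first variation `δF(γ,h)`, the derivative of `τ ↦ F(γ + τ h)` at `τ = 0`, exists and
equals `d`. The functional has to be finite near `γ` along the line. -/
def HasFirstVariation {E : Type*} [NormedAddCommGroup E] [NormedSpace ℝ E]
    (F : (ℝ → E) → ℝ≥0∞) (γ h : ℝ → E) (d : ℝ) : Prop :=
  (∀ᶠ τ : ℝ in 𝓝 0, F (γ + τ • h) ≠ ⊤) ∧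
    HasDerivAt (fun τ : ℝ => (F (γ + τ • h)).toReal) d 0

/-- The second variation `δ²F(γ)[h,g]`, the derivative of `τ ↦ δF(γ + τ g, h)` at `τ = 0`,
exists and equals `d`. -/
def HasSecondVariation {E : Type*} [NormedAddCommGroup E] [NormedSpace ℝ E]
    (F : (ℝ → E) → ℝ≥0∞) (γ h g : ℝ → E) (d : ℝ) : Prop :=
  ∃ δF : ℝ → ℝ, (∀ᶠ τ : ℝ in 𝓝 0, HasFirstVariation F (γ + τ • g) h (δF τ)) ∧
    HasDerivAt δF d 0

/-- A constant `C(b,a)` that is non-increasing in `b > 0` and non-decreasing in `a ≥ 0`. -/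
def IsMonotoneConstant (C : ℝ → ℝ → ℝ) : Prop :=
  (∀ a, 0 ≤ a → AntitoneOn (fun b => C b a) (Ioi 0)) ∧
    ∀ b, 0 < b → MonotoneOn (fun a => C b a) (Ici 0)

end Menger

/-!
In the coordinates `(u, u + v, u + w)` the wedge product of two chords is `v w` times the wedge
product of an average of `γ'` with the difference of two such averages, the *defect* of `γ`. The
energy therefore is the integral, against a fixed singular measure, of a quadratic form in the
defect whose coefficients depend smoothly on averages and values of `γ'`. Since the energy density
is symmetric in the three points, it may be weighted by the share of the side opposite to `u`,
`|v - w|^p / (|v - w|^p + |v|^p + |w|^p)`. This removes the singularity at `v = w` and makes the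
defect of a function `f` square integrable, with norm at most a constant times `[f']_{s,2}`.

By a Morrey estimate the averages and values of `γ'` are bounded above in terms of `[γ']_{s,2}`, and
they are bounded below by the bilipschitz constant, so they stay in a compact set on which the form
is smooth. Hence the energy may be differentiated under the integral. The derivative is again the
integral of a quadratic form in the defects, so this applies twice, and it bounds both variations
uniformly for directions of seminorm at most one; homogeneity gives the general bounds.
-/

namespace Menger

section WeakDerivative

variable {E : Type*} [NormedAddCommGroup E]

theorem intervalIntegrable_of_locallyIntegrable {g : ℝ → E} (hg : LocallyIntegrable g)
    (a b : ℝ) : IntervalIntegrable g volume a b :=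
  intervalIntegrable_iff.2 ((hg.integrableOn_isCompact isCompact_uIcc).mono_set uIoc_subset_uIcc)

variable [NormedSpace ℝ E]

theorem hasDerivAt_integral_window [CompleteSpace E] {ψ : ℝ → E} (hψ : Continuous ψ) (l x : ℝ) :
    HasDerivAt (fun x => ∫ y in (x - l)..x, ψ y) (ψ x - ψ (x - l)) x := by
  have primitive (x : ℝ) : HasDerivAt (fun x => ∫ y in (0 : ℝ)..x, ψ y) (ψ x) x :=
    intervalIntegral.integral_hasDerivAt_right (hψ.intervalIntegrable _ _)
      (hψ.stronglyMeasurableAtFilter _ _) hψ.continuousAt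
  refine ((primitive x).sub ((primitive (x - l)).comp_sub_const x l)).congr_of_eventuallyEq ?_
  exact .of_forall fun z => (intervalIntegral.integral_interval_sub_left
    (hψ.intervalIntegrable _ _) (hψ.intervalIntegrable _ _)).symm

theorem contDiff_integral_window [CompleteSpace E] {ψ : ℝ → E} (hψ : ContDiff ℝ ∞ ψ) (l : ℝ) :
    ContDiff ℝ ∞ fun x => ∫ y in (x - l)..x, ψ y := by
  have hd := hasDerivAt_integral_window hψ.continuous l
  refine contDiff_infty_iff_deriv.2 ⟨fun x => (hd x).differentiableAt, ?_⟩
  rw [funext fun x => (hd x).deriv]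
  exact hψ.sub (hψ.comp (contDiff_id.sub contDiff_const))

theorem hasCompactSupport_integral_window {ψ : ℝ → E} (hψ : HasCompactSupport ψ) {l : ℝ}
    (hl : 0 ≤ l) : HasCompactSupport fun x => ∫ y in (x - l)..x, ψ y := by
  refine .intro (hψ.isCompact.add (isCompact_Icc (a := 0) (b := l))) fun x hx => ?_
  refine intervalIntegral.integral_zero_ae (.of_forall fun y hy => ?_)
  rw [uIoc_of_le (by linarith)] at hy
  refine image_eq_zero_of_notMem_tsupport fun hy' => hx ?_
  exact ⟨y, hy', x - y, ⟨by linarith [hy.2], by linarith [hy.1]⟩, add_sub_cancel y x⟩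

open scoped Pointwise in
theorem integrable_smul_indicator_window {ψ : ℝ → ℝ} (hψ : Continuous ψ)
    (hψc : HasCompactSupport ψ) {g : ℝ → E} (hg : LocallyIntegrable g) (l : ℝ) :
    Integrable (fun q : ℝ × ℝ => ψ q.1 • (Ioc q.1 (q.1 + l)).indicator g q.2)
      (volume.prod volume) := by
  set K := tsupport ψ + Icc 0 l
  have hK : IsCompact K := hψc.isCompact.add isCompact_Icc
  have hgK : Integrable (K.indicator g) :=
    (integrable_indicator_iff hK.measurableSet).2 (hg.integrableOn_isCompact hK)
  have window : MeasurableSet {q : ℝ × ℝ | q.2 ∈ Ioc q.1 (q.1 + l)} :=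
    (measurableSet_lt measurable_fst measurable_snd).inter
      (measurableSet_le measurable_snd (measurable_fst.add_const l))
  refine ((hψ.integrable_of_hasCompactSupport hψc).norm.mul_prod hgK.norm).mono' ?_
    (.of_forall fun q => ?_)
  · exact (hψ.aestronglyMeasurable.comp_fst).smul
      (hg.aestronglyMeasurable.comp_snd.indicator window)
  · rw [norm_smul]
    by_cases hq : q.1 ∈ tsupport ψ
    · gcongr
      refine norm_indicator_le_of_subset (fun z hz => ?_) g q.2
      exact ⟨q.1, hq, z - q.1, ⟨by linarith [hz.1], by linarith [hz.2]⟩, add_sub_cancel q.1 z⟩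
    · rw [image_eq_zero_of_notMem_tsupport hq, norm_zero, zero_mul, zero_mul]

theorem integral_smul_integral_window [CompleteSpace E] {ψ : ℝ → ℝ} (hψ : Continuous ψ)
    (hψc : HasCompactSupport ψ) {g : ℝ → E} (hg : LocallyIntegrable g) {l : ℝ} (hl : 0 ≤ l) :
    ∫ y, ψ y • ∫ x in y..(y + l), g x = ∫ x, (∫ y in (x - l)..x, ψ y) • g x := by
  have left (y : ℝ) : ψ y • ∫ x in y..(y + l), g x =
      ∫ x, ψ y • (Ioc y (y + l)).indicator g x := by
    rw [integral_smul, integral_indicator measurableSet_Ioc,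
      intervalIntegral.integral_of_le (by linarith)]
  have right (x : ℝ) : (∫ y in (x - l)..x, ψ y) • g x =
      ∫ y, ψ y • (Ioc y (y + l)).indicator g x := by
    rw [intervalIntegral.integral_of_le (by linarith), integral_Ioc_eq_integral_Ioo,
      ← integral_Ico_eq_integral_Ioo, ← integral_indicator measurableSet_Ico,
      ← integral_smul_const]
    congr 1 with y
    have : y ∈ Ico (x - l) x ↔ x ∈ Ioc y (y + l) := by
      simp only [mem_Ico, mem_Ioc, sub_le_iff_le_add, and_comm]
    by_cases h : x ∈ Ioc y (y + l)
    · rw [indicator_of_mem h, indicator_of_mem (this.2 h)]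
    · rw [indicator_of_notMem h, indicator_of_notMem (this.not.2 h), smul_zero, zero_smul]
  simp_rw [left, right]
  exact integral_integral_swap (integrable_smul_indicator_window hψ hψc hg l)

theorem HasWeakDeriv.sub_eq_integral [CompleteSpace E] {f g : ℝ → E} (h : HasWeakDeriv f g)
    (hf : Continuous f) {a b : ℝ} (hab : a ≤ b) : f b - f a = ∫ x in a..b, g x := by
  obtain ⟨-, hg, hfg⟩ := h
  obtain ⟨l, hl, rfl⟩ : ∃ l, 0 ≤ l ∧ b = a + l := ⟨b - a, sub_nonneg.2 hab, by ring⟩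
  have hgi := intervalIntegrable_of_locallyIntegrable hg
  have hG : Continuous fun y => ∫ x in y..(y + l), g x := by
    have hP := intervalIntegral.continuous_primitive hgi 0
    refine ((hP.comp (continuous_add_const l)).sub hP).congr fun y => ?_
    exact intervalIntegral.integral_interval_sub_left (hgi _ _) (hgi _ _)
  have hF : Continuous fun y => f (y + l) - f y := by fun_prop
  refine congrFun (Continuous.ae_eq_iff_eq volume hF hG |>.1
    (ae_eq_of_integral_contDiff_smul_eq hF.locallyIntegrable hG.locallyIntegrable
      fun ψ hψ hψc => ?_)) a
  have integrable_smul {u : ℝ → ℝ} (hu : Continuous u) (huc : HasCompactSupport u) :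
      Integrable fun y => u y • f y :=
    (hu.smul hf).integrable_of_hasCompactSupport huc.smul_right
  have hψl : HasCompactSupport fun y => ψ (y - l) := hψc.comp_homeomorph (Homeomorph.subRight l)
  calc ∫ y, ψ y • (f (y + l) - f y)
      = (∫ y, ψ (y + l - l) • f (y + l)) - ∫ y, ψ y • f y := by
        simp_rw [smul_sub, add_sub_cancel_right]
        refine integral_sub ?_ (integrable_smul hψ.continuous hψc)
        exact ((hψ.continuous.smul (by fun_prop)).integrable_of_hasCompactSupport hψc.smul_right)
    _ = -∫ y, (ψ y - ψ (y - l)) • f y := by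
        simp_rw [sub_smul]
        rw [integral_add_right_eq_self fun y => ψ (y - l) • f y, integral_sub
          (integrable_smul hψ.continuous hψc) (integrable_smul (by fun_prop) hψl), neg_sub]
    _ = ∫ x, (∫ y in (x - l)..x, ψ y) • g x := by
        rw [neg_eq_iff_eq_neg, ← hfg _ (contDiff_integral_window hψ l)
          (hasCompactSupport_integral_window hψc hl)]
        simp_rw [(hasDerivAt_integral_window hψ.continuous l _).deriv]
    _ = ∫ y, ψ y • ∫ x in y..(y + l), g x :=
        (integral_smul_integral_window hψ.continuous hψc hg hl).symm

end WeakDerivative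

section Slobodeckij

theorem sq_lintegral_le {α : Type*} [MeasurableSpace α] {μ : Measure α} {φ : α → ℝ≥0∞}
    (hφ : AEMeasurable φ μ) : (∫⁻ x, φ x ∂μ) ^ 2 ≤ μ univ * ∫⁻ x, φ x ^ 2 ∂μ := by
  have h := ENNReal.lintegral_mul_le_Lp_mul_Lq μ (Real.HolderConjugate.two_two) hφ
    (aemeasurable_const (b := (1 : ℝ≥0∞)))
  simp only [Pi.mul_apply, mul_one, ENNReal.one_rpow, lintegral_const, one_mul] at h
  calc (∫⁻ x, φ x ∂μ) ^ 2
      ≤ ((∫⁻ a, φ a ^ (2 : ℝ) ∂μ) ^ (1 / 2 : ℝ) * μ univ ^ (1 / 2 : ℝ)) ^ 2 := by gcongr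
    _ = μ univ * ∫⁻ x, φ x ^ 2 ∂μ := by
      rw [mul_pow, ← ENNReal.rpow_natCast, ← ENNReal.rpow_mul, ← ENNReal.rpow_natCast,
        ← ENNReal.rpow_mul, mul_comm]
      norm_num

theorem lintegral_Ioc_periodic {H : ℝ → ℝ≥0∞} (hH : Function.Periodic H 1) (a b : ℝ) :
    ∫⁻ u in Ioc a (a + 1), H u = ∫⁻ u in Ioc b (b + 1), H u := by
  refine (isAddFundamentalDomain_Ioc zero_lt_one a).setLIntegral_eq
    (isAddFundamentalDomain_Ioc zero_lt_one b) H ?_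
  rintro ⟨g, hg⟩ x
  obtain ⟨k, rfl⟩ := AddSubgroup.mem_zmultiples_iff.1 hg
  simpa [AddSubgroup.vadd_def, add_comm] using hH.zsmul k x

variable {E : Type*} [NormedAddCommGroup E] {s : ℝ} {f g : ℝ → E}

theorem slobodeckij_sq (s : ℝ) (f : ℝ → E) : slobodeckij s f ^ 2 =
    ∫⁻ u in Ioc (0 : ℝ) 1, ∫⁻ w in Ioo (-(1 / 2) : ℝ) (1 / 2),
      ENNReal.ofReal (‖f (u + w) - f u‖ ^ 2 / |w| ^ (1 + 2 * s)) := by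
  rw [slobodeckij, ← ENNReal.rpow_natCast, ← ENNReal.rpow_mul]
  norm_num

theorem slobodeckij_congr_ae (h : f =ᵐ[volume] g) : slobodeckij s f = slobodeckij s g := by
  rw [slobodeckij, slobodeckij]
  congr 1
  refine lintegral_congr_ae (ae_restrict_of_ae ?_)
  filter_upwards [h] with u hu
  refine lintegral_congr_ae (ae_restrict_of_ae ?_)
  filter_upwards [(measurePreserving_add_left volume u).quasiMeasurePreserving.ae h] with w hw
  rw [hu, hw]

theorem enorm_sq_le_rpow_mul_div (hs : 0 ≤ 1 + 2 * s) (e : E) {w d : ℝ} (hw : w ≠ 0)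
    (hwd : |w| ≤ d) : ‖e‖ₑ ^ 2 ≤
      ENNReal.ofReal (d ^ (1 + 2 * s)) * ENNReal.ofReal (‖e‖ ^ 2 / |w| ^ (1 + 2 * s)) := by
  have hw : 0 < |w| := abs_pos.2 hw
  have hd : 0 ≤ d ^ (1 + 2 * s) := Real.rpow_nonneg (hw.le.trans hwd) _
  rw [← ofReal_norm, ← ENNReal.ofReal_pow (norm_nonneg _), ← ENNReal.ofReal_mul hd]
  refine ENNReal.ofReal_le_ofReal ?_
  rw [← mul_div_assoc, le_div_iff₀ (Real.rpow_pos_of_pos hw _), mul_comm]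
  gcongr

theorem lintegral_lintegral_le_slobodeckij (hs : 0 ≤ 1 + 2 * s) (hg : Function.Periodic g 1)
    {a b c : ℝ} (hbc : b ≤ c) (hac : c ≤ a + 1 / 2) :
    ∫⁻ y in Ioc a b, ∫⁻ z in Ioc b c, ‖g y - g z‖ₑ ^ 2 ≤
      ENNReal.ofReal ((c - a) ^ (1 + 2 * s)) * slobodeckij s g ^ 2 := by
  let H (u : ℝ) := ∫⁻ w in Ioo (-(1 / 2) : ℝ) (1 / 2),
    ENNReal.ofReal (‖g (u + w) - g u‖ ^ 2 / |w| ^ (1 + 2 * s))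
  have periodic_H : Function.Periodic H 1 := fun u => lintegral_congr fun w => by
    rw [hg u, add_right_comm, hg]
  have inner (y : ℝ) (hy : y ∈ Ioc a b) : ∫⁻ z in Ioc b c, ‖g y - g z‖ₑ ^ 2 ≤
      ENNReal.ofReal ((c - a) ^ (1 + 2 * s)) * H y := by
    rw [← lintegral_indicator measurableSet_Ioc, ← lintegral_add_left_eq_self _ y,
      ← lintegral_const_mul' _ _ ENNReal.ofReal_ne_top, ← lintegral_indicator measurableSet_Ioo]
    refine lintegral_mono fun w => ?_
    by_cases hw : y + w ∈ Ioc b c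
    · have w_pos : 0 < w := by linarith [hw.1, hy.2]
      have w_lt : w < c - a := by linarith [hw.2, hy.1]
      have w_mem : w ∈ Ioo (-(1 / 2) : ℝ) (1 / 2) := ⟨by linarith, by linarith⟩
      rw [indicator_of_mem hw, indicator_of_mem w_mem, enorm_sub_rev]
      exact enorm_sq_le_rpow_mul_div hs _ w_pos.ne' ((abs_of_pos w_pos).trans_le w_lt.le)
    · rw [indicator_of_notMem hw]
      exact zero_le
  calc ∫⁻ y in Ioc a b, ∫⁻ z in Ioc b c, ‖g y - g z‖ₑ ^ 2
      ≤ ∫⁻ y in Ioc a b, ENNReal.ofReal ((c - a) ^ (1 + 2 * s)) * H y :=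
        setLIntegral_mono' measurableSet_Ioc inner
    _ ≤ ∫⁻ y in Ioc a (a + 1), ENNReal.ofReal ((c - a) ^ (1 + 2 * s)) * H y :=
        lintegral_mono_set (Ioc_subset_Ioc_right (by linarith))
    _ = ENNReal.ofReal ((c - a) ^ (1 + 2 * s)) * slobodeckij s g ^ 2 := by
        rw [lintegral_const_mul' _ _ ENNReal.ofReal_ne_top, lintegral_Ioc_periodic periodic_H a 0,
          zero_add, slobodeckij_sq]

variable [NormedSpace ℝ E]

theorem enorm_smul_integral_sub_smul_integral_sq_le {α β : Type*} [MeasurableSpace α]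
    [MeasurableSpace β] {μ : Measure α} {ν : Measure β} [IsFiniteMeasure μ] [IsFiniteMeasure ν]
    {f : α → E} {g : β → E} (hf : Integrable f μ) (hg : Integrable g ν) :
    ‖ν.real univ • ∫ x, f x ∂μ - μ.real univ • ∫ y, g y ∂ν‖ₑ ^ 2 ≤
      μ univ * ν univ * ∫⁻ x, ∫⁻ y, ‖f x - g y‖ₑ ^ 2 ∂ν ∂μ := by
  have hfg : AEMeasurable (fun q : α × β => ‖f q.1 - g q.2‖ₑ) (μ.prod ν) :=
    (hf.aestronglyMeasurable.comp_fst.sub hg.aestronglyMeasurable.comp_snd).enorm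
  have average : ∫ q, (f q.1 - g q.2) ∂μ.prod ν =
      ν.real univ • ∫ x, f x ∂μ - μ.real univ • ∫ y, g y ∂ν := by
    rw [integral_sub (hf.comp_fst ν) (hg.comp_snd μ), integral_fun_fst, integral_fun_snd]
  rw [← average, ← lintegral_prod _ (hfg.pow_const 2), ← Measure.prod_prod, univ_prod_univ]
  exact (pow_le_pow_left' (enorm_integral_le_lintegral_enorm _) 2).trans (sq_lintegral_le hfg)

theorem enorm_integral_sub_integral_le (hs : 0 ≤ 1 + 2 * s) (hgi : LocallyIntegrable g)
    (hg : Function.Periodic g 1) {x l : ℝ} (hl : 0 < l) (hl4 : l ≤ 1 / 4) :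
    ‖(∫ y in x..(x + l), g y) - ∫ z in (x + l)..(x + 2 * l), g z‖ₑ ≤
      ENNReal.ofReal ((2 * l) ^ (s + 1 / 2)) * slobodeckij s g := by
  have hi (a b : ℝ) : IntegrableOn g (Ioc a b) :=
    (hgi.integrableOn_isCompact isCompact_Icc).mono_set Ioc_subset_Icc_self
  have hl₂ : x + 2 * l - (x + l) = l := by ring
  have h := enorm_smul_integral_sub_smul_integral_sq_le (hi x (x + l)) (hi (x + l) (x + 2 * l))
  simp only [measureReal_restrict_apply_univ, Measure.restrict_apply_univ, Real.volume_real_Ioc,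
    Real.volume_Ioc, add_sub_cancel_left, hl₂, max_eq_left hl.le] at h
  rw [← smul_sub, enorm_smul, Real.enorm_eq_ofReal hl.le, ← sq, mul_pow,
    ENNReal.mul_le_mul_iff_right (by simpa using hl) (by simp)] at h
  rw [intervalIntegral.integral_of_le (by linarith), intervalIntegral.integral_of_le (by linarith),
    ← ENNReal.pow_le_pow_left_iff two_ne_zero]
  refine h.trans <|
    (lintegral_lintegral_le_slobodeckij hs hg (by linarith) (by linarith)).trans_eq ?_
  rw [mul_pow, ← ENNReal.ofReal_pow (by positivity), ← Real.rpow_natCast,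
    ← Real.rpow_mul (by positivity)]
  congr 3 <;> push_cast <;> ring

end Slobodeckij

section Embedding

variable {E : Type*} [NormedAddCommGroup E] [NormedSpace ℝ E] {s N : ℝ} {f g : ℝ → E}

/-- The constant of the embedding of `W^{s,2}`, restricted to functions of mean value zero, into
the bounded functions. -/
noncomputable def morreyConst (s : ℝ) : ℝ := 6 + 1 / (1 - (1 / 2 : ℝ) ^ (s - 1 / 2))

theorem half_rpow_lt_one (hs : 1 / 2 < s) : (1 / 2 : ℝ) ^ (s - 1 / 2) < 1 :=
  Real.rpow_lt_one (by norm_num) (by norm_num) (by linarith)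

theorem morreyConst_nonneg (hs : 1 / 2 < s) : 0 ≤ morreyConst s := by
  have := sub_pos.2 (half_rpow_lt_one hs)
  unfold morreyConst
  positivity

/-- The second differences of `f` with step `l` are bounded by `N` times the power `s + 1 / 2` of
`2 * l`, a Zygmund condition that makes `f` continuously differentiable if `s > 1 / 2`. -/
def SecondDiffBound (s N : ℝ) (f : ℝ → E) : Prop :=
  ∀ x l : ℝ, 0 < l → l ≤ 1 / 4 →
    ‖f (x + 2 * l) - (2 : ℝ) • f (x + l) + f x‖ ≤ (2 * l) ^ (s + 1 / 2) * N

/-- The forward difference quotient of step `2⁻⁽ᵏ⁺²⁾`. -/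
noncomputable def dyadicQuotient (f : ℝ → E) (k : ℕ) (x : ℝ) : E :=
  (2 : ℝ) ^ (k + 2) • (f (x + ((2 : ℝ) ^ (k + 2))⁻¹) - f x)

theorem two_pow_mul_inv_rpow (s : ℝ) (m : ℕ) :
    (2 : ℝ) ^ m * ((2 : ℝ) ^ m)⁻¹ ^ (s + 1 / 2) = ((1 / 2 : ℝ) ^ (s - 1 / 2)) ^ m := by
  have h : (0 : ℝ) < (2 ^ m)⁻¹ := by positivity
  rw [Real.rpow_pow_comm one_half_pos.le, one_div, inv_pow,
    show s + 2⁻¹ = 1 + (s - 2⁻¹) by ring, Real.rpow_add h, Real.rpow_one, ← mul_assoc,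
    mul_inv_cancel₀ (by positivity), one_mul]

theorem SecondDiffBound.dist_dyadicQuotient_succ_le (hf : SecondDiffBound s N f) (hs : 1 / 2 < s)
    (hN : 0 ≤ N) (k : ℕ) (x : ℝ) : dist (dyadicQuotient f k x) (dyadicQuotient f (k + 1) x) ≤
      N * ((1 / 2 : ℝ) ^ (s - 1 / 2)) ^ k := by
  obtain ⟨l, hl⟩ : ∃ l, l = ((2 : ℝ) ^ (k + 3))⁻¹ := ⟨_, rfl⟩
  have h2l : ((2 : ℝ) ^ (k + 2))⁻¹ = 2 * l := by rw [hl, pow_succ _ (k + 2)]; field_simp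
  have hl4 : l ≤ 1 / 4 := by
    rw [hl, one_div]
    refine inv_anti₀ (by norm_num) ?_
    calc (4 : ℝ) = 2 ^ 2 := by norm_num
      _ ≤ 2 ^ (k + 3) := pow_le_pow_right₀ one_le_two (by omega)
  have second_difference : dyadicQuotient f k x - dyadicQuotient f (k + 1) x =
      (2 : ℝ) ^ (k + 2) • (f (x + 2 * l) - (2 : ℝ) • f (x + l) + f x) := by
    unfold dyadicQuotient
    rw [h2l, show k + 1 + 2 = k + 3 by ring, ← hl, pow_succ _ (k + 2)]
    module
  calc dist (dyadicQuotient f k x) (dyadicQuotient f (k + 1) x)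
      = (2 : ℝ) ^ (k + 2) * ‖f (x + 2 * l) - (2 : ℝ) • f (x + l) + f x‖ := by
        rw [dist_eq_norm, second_difference, norm_smul, Real.norm_of_nonneg (by positivity)]
    _ ≤ (2 : ℝ) ^ (k + 2) * ((2 * l) ^ (s + 1 / 2) * N) := by
        gcongr
        exact hf x l (by rw [hl]; positivity) hl4
    _ = N * ((1 / 2 : ℝ) ^ (s - 1 / 2)) ^ (k + 2) := by
        rw [← h2l, ← mul_assoc, two_pow_mul_inv_rpow, mul_comm]
    _ ≤ N * ((1 / 2 : ℝ) ^ (s - 1 / 2)) ^ k := by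
        gcongr ?_ * ?_
        exact pow_le_pow_of_le_one (by positivity) (half_rpow_lt_one hs).le (by omega)

theorem SecondDiffBound.norm_dyadicQuotient_zero_le (hf : SecondDiffBound s N f) (hs : 1 / 2 < s)
    (hN : 0 ≤ N) (hper : Function.Periodic f 1) (x : ℝ) : ‖dyadicQuotient f 0 x‖ ≤ 6 * N := by
  have quarter (y : ℝ) : ‖f (y + 1 / 2) - (2 : ℝ) • f (y + 1 / 4) + f y‖ ≤ N := by
    have := hf y (1 / 4) (by norm_num) le_rfl
    norm_num at this ⊢
    refine this.trans (mul_le_of_le_one_left hN ?_)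
    exact Real.rpow_le_one (by norm_num) (by norm_num) (by linarith)
  have telescope : dyadicQuotient f 0 x =
      -((3 : ℝ) • (f (x + 1 / 2) - (2 : ℝ) • f (x + 1 / 4) + f x) +
        (2 : ℝ) • (f (x + 1 / 4 + 1 / 2) - (2 : ℝ) • f (x + 1 / 4 + 1 / 4) + f (x + 1 / 4)) +
        (f (x + 1 / 2 + 1 / 2) - (2 : ℝ) • f (x + 1 / 2 + 1 / 4) + f (x + 1 / 2))) := by
    unfold dyadicQuotient
    rw [show x + 1 / 2 + 1 / 2 = x + 1 by ring, hper,
      show x + 1 / 4 + 1 / 4 = x + 1 / 2 by ring,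
      show x + 1 / 4 + 1 / 2 = x + 1 / 2 + 1 / 4 by ring]
    norm_num
    module
  rw [telescope, norm_neg]
  refine norm_add₃_le.trans ?_
  rw [norm_smul, norm_smul, Real.norm_of_nonneg (by norm_num), Real.norm_of_nonneg (by norm_num)]
  linarith [quarter x, quarter (x + 1 / 4), quarter (x + 1 / 2)]

theorem tendsto_dyadicQuotient {e : E} {x : ℝ} (hf : HasDerivAt f e x) :
    Tendsto (fun k => dyadicQuotient f k x) atTop (𝓝 e) := by
  have step_tendsto : Tendsto (fun k : ℕ => x + ((2 : ℝ) ^ (k + 2))⁻¹) atTop (𝓝[≠] x) := by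
    refine tendsto_nhdsWithin_iff.2 ⟨?_, .of_forall fun k => by simp⟩
    have : Tendsto (fun k : ℕ => ((2 : ℝ) ^ (k + 2))⁻¹) atTop (𝓝 0) :=
      tendsto_inv_atTop_zero.comp
        ((tendsto_pow_atTop_atTop_of_one_lt one_lt_two).comp (tendsto_add_atTop_nat 2))
    simpa using this.const_add x
  refine (hf.tendsto_slope.comp step_tendsto).congr fun k => ?_
  simp [slope, dyadicQuotient]

variable [CompleteSpace E]

theorem SecondDiffBound.exists_dist_dyadicQuotient_le (hf : SecondDiffBound s N f)
    (hs : 1 / 2 < s) (hN : 0 ≤ N) : ∃ G : ℝ → E, ∀ k x, dist (dyadicQuotient f k x) (G x) ≤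
      N * ((1 / 2 : ℝ) ^ (s - 1 / 2)) ^ k / (1 - (1 / 2 : ℝ) ^ (s - 1 / 2)) := by
  have hr := half_rpow_lt_one hs
  have step (x : ℝ) (k : ℕ) := hf.dist_dyadicQuotient_succ_le hs hN k x
  choose G hG using fun x =>
    cauchySeq_tendsto_of_complete (cauchySeq_of_le_geometric _ N hr (step x))
  exact ⟨G, fun k x => dist_le_of_le_geometric_of_tendsto _ N hr (step x) (hG x) k⟩

theorem SecondDiffBound.exists_tendstoUniformly_dyadicQuotient (hf : SecondDiffBound s N f)
    (hs : 1 / 2 < s) (hN : 0 ≤ N) (hper : Function.Periodic f 1) :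
    ∃ G : ℝ → E, TendstoUniformly (dyadicQuotient f) G atTop ∧ ∀ x, ‖G x‖ ≤ morreyConst s * N := by
  obtain ⟨G, hG⟩ := hf.exists_dist_dyadicQuotient_le hs hN
  refine ⟨G, Metric.tendstoUniformly_iff.2 fun ε hε => ?_, fun x => ?_⟩
  · have error_tendsto := ((tendsto_pow_atTop_nhds_zero_of_lt_one (by positivity)
      (half_rpow_lt_one hs)).const_mul N).div_const (1 - (1 / 2 : ℝ) ^ (s - 1 / 2))
    rw [mul_zero, zero_div] at error_tendsto
    filter_upwards [error_tendsto.eventually_lt_const hε] with k hk x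
    rw [dist_comm]
    exact (hG k x).trans_lt hk
  · calc ‖G x‖ ≤ ‖dyadicQuotient f 0 x‖ + ‖dyadicQuotient f 0 x - G x‖ :=
          norm_le_norm_add_norm_sub _ _
      _ ≤ 6 * N + N * ((1 / 2 : ℝ) ^ (s - 1 / 2)) ^ 0 / (1 - (1 / 2 : ℝ) ^ (s - 1 / 2)) :=
          add_le_add (hf.norm_dyadicQuotient_zero_le hs hN hper x)
            ((dist_eq_norm _ _).symm.trans_le (hG 0 x))
      _ = morreyConst s * N := by rw [morreyConst]; ring

theorem HasWeakDeriv.secondDiffBound (h : HasWeakDeriv f g) (hf : Continuous f)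
    (hg : Function.Periodic g 1) (hs : 0 ≤ 1 + 2 * s) (hfin : slobodeckij s g ≠ ⊤) :
    SecondDiffBound s (slobodeckijReal s g) f := by
  intro x l hl hl4
  have hle := enorm_integral_sub_integral_le hs h.2.1 hg (x := x) hl hl4
  rw [← h.sub_eq_integral hf (by linarith), ← h.sub_eq_integral hf (by linarith)] at hle
  have := ENNReal.toReal_mono (ENNReal.mul_ne_top ENNReal.ofReal_ne_top hfin) hle
  rw [toReal_enorm, ENNReal.toReal_mul, ENNReal.toReal_ofReal (by positivity), ← norm_neg] at this
  exact (congrArg norm (by module)).trans_le this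

theorem HasWeakDeriv.hasDerivAt_of_integral (h : HasWeakDeriv f g) (hf : Continuous f) {e : E}
    {x : ℝ} (hx : HasDerivAt (fun y => ∫ t in (x - 1)..y, g t) e x) : HasDerivAt f e x := by
  refine (hx.add_const (f (x - 1))).congr_of_eventuallyEq ?_
  filter_upwards [Ioi_mem_nhds (sub_one_lt x)] with y hy
  rw [← h.sub_eq_integral hf (le_of_lt hy), sub_add_cancel]

theorem HasWeakDeriv.ae_hasDerivAt (h : HasWeakDeriv f g) (hf : Continuous f) :
    ∀ᵐ x, HasDerivAt f (g x) x := by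
  filter_upwards [LocallyIntegrable.ae_hasDerivAt_integral h.2.1] with x hx
  exact h.hasDerivAt_of_integral hf (hx (x - 1))

theorem HasWeakDeriv.hasDerivAt_of_continuous {G : ℝ → E} (h : HasWeakDeriv f g)
    (hf : Continuous f) (hgG : g =ᵐ[volume] G) (hG : Continuous G) (x : ℝ) :
    HasDerivAt f (G x) x := by
  refine h.hasDerivAt_of_integral hf ?_
  simp_rw [intervalIntegral.integral_congr_ae (hgG.mono fun _ ht _ => ht)]
  exact intervalIntegral.integral_hasDerivAt_right (hG.intervalIntegrable _ _)
    (hG.stronglyMeasurableAtFilter _ _) hG.continuousAt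

theorem MemW.exists_hasDerivAt (hs : 1 / 2 < s) (h : MemW s f) :
    ∃ G : ℝ → E, Continuous G ∧ (∀ x, HasDerivAt f (G x) x) ∧ slobodeckij s G ≠ ⊤ ∧
      ∀ x, ‖G x‖ ≤ morreyConst s * slobodeckijReal s G := by
  obtain ⟨hper, hf, g, hgper, hg, -, hfin⟩ := h
  obtain ⟨G, hfG, hGb⟩ := (hg.secondDiffBound hf hgper (by linarith) hfin)
    |>.exists_tendstoUniformly_dyadicQuotient hs ENNReal.toReal_nonneg hper
  have hG : Continuous G := hfG.continuous (.of_forall fun k => by unfold dyadicQuotient; fun_prop)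
  have hgG : g =ᵐ[volume] G := by
    filter_upwards [hg.ae_hasDerivAt hf] with x hx
    exact tendsto_nhds_unique (tendsto_dyadicQuotient hx) (hfG.tendsto_at x)
  rw [slobodeckijReal, slobodeckij_congr_ae hgG] at hGb
  exact ⟨G, hG, hg.hasDerivAt_of_continuous hf hgG hG, slobodeckij_congr_ae hgG ▸ hfin, hGb⟩

theorem MemW.contDiff (hs : 1 / 2 < s) (h : MemW s f) : ContDiff ℝ 1 f := by
  obtain ⟨G, hG, hfG, -⟩ := h.exists_hasDerivAt hs
  exact contDiff_one_iff_deriv.2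
    ⟨fun x => (hfG x).differentiableAt, (funext fun x => (hfG x).deriv) ▸ hG⟩

theorem MemW.slobodeckij_deriv_ne_top (hs : 1 / 2 < s) (h : MemW s f) :
    slobodeckij s (deriv f) ≠ ⊤ := by
  obtain ⟨G, -, hfG, hfin, -⟩ := h.exists_hasDerivAt hs
  rwa [funext fun x => (hfG x).deriv]

theorem MemW.norm_deriv_le (hs : 1 / 2 < s) (h : MemW s f) (x : ℝ) :
    ‖deriv f x‖ ≤ morreyConst s * slobodeckijReal s (deriv f) := by
  obtain ⟨G, -, hfG, -, hGb⟩ := h.exists_hasDerivAt hs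
  rw [funext fun x => (hfG x).deriv]
  exact hGb x

end Embedding

section Prolongation

set_option maxSynthPendingDepth 3

variable {Y E : Type*} [NormedAddCommGroup Y] [NormedSpace ℝ Y]
  [NormedAddCommGroup E] [NormedSpace ℝ E]
  {B : Y → E →L[ℝ] E →L[ℝ] ℝ} {U : Set Y}

/-- The tangent prolongation of a family `B` of bilinear forms: its quadratic form at the base
point `(y, η)` and the vector `(e, ε)` is the derivative of `B y e e` in the direction `(η, ε)`.
Being of the same type as `B`, it can be prolonged again to compute second derivatives. -/
noncomputable def prolong (B : Y → E →L[ℝ] E →L[ℝ] ℝ) (z : Y × Y) : E × E →L[ℝ] E × E →L[ℝ] ℝ :=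
  (fderiv ℝ B z.1 z.2).bilinearComp (.fst ℝ E E) (.fst ℝ E E) +
    (B z.1).bilinearComp (.snd ℝ E E) (.fst ℝ E E) +
    (B z.1).bilinearComp (.fst ℝ E E) (.snd ℝ E E)

theorem prolong_apply_apply (B : Y → E →L[ℝ] E →L[ℝ] ℝ) (y η : Y) (e ε : E) :
    prolong B (y, η) (e, ε) (e, ε) = fderiv ℝ B y η e e + B y ε e + B y e ε := rfl

theorem contDiffOn_bilinearComp {Z F F' : Type*} [NormedAddCommGroup Z] [NormedSpace ℝ Z]
    [NormedAddCommGroup F] [NormedSpace ℝ F] [NormedAddCommGroup F'] [NormedSpace ℝ F']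
    {k : WithTop ℕ∞} {A : Z → E →L[ℝ] E →L[ℝ] ℝ} {V : Set Z} (hA : ContDiffOn ℝ k A V)
    (f : F →L[ℝ] E) (f' : F' →L[ℝ] E) :
    ContDiffOn ℝ k (fun z => (A z).bilinearComp f f') V := by
  let R : (E →L[ℝ] ℝ) →L[ℝ] F' →L[ℝ] ℝ := (ContinuousLinearMap.compL ℝ F' E ℝ).flip f'
  exact (contDiffOn_const (c := R)).clm_comp (hA.clm_comp (contDiffOn_const (c := f)))

theorem contDiffOn_prolong {k : WithTop ℕ∞} (hU : IsOpen U) (hB : ContDiffOn ℝ (k + 1) B U) :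
    ContDiffOn ℝ k (prolong B) (U ×ˢ univ) := by
  have base : MapsTo Prod.fst (U ×ˢ (univ : Set Y)) U := fun z hz => hz.1
  have hB₀ : ContDiffOn ℝ k (fun z : Y × Y => B z.1) (U ×ˢ univ) :=
    (hB.of_le le_self_add).comp contDiffOn_fst base
  have hB₁ : ContDiffOn ℝ k (fun z : Y × Y => fderiv ℝ B z.1 z.2) (U ×ˢ univ) :=
    ((hB.fderiv_of_isOpen hU le_rfl).comp contDiffOn_fst base).clm_apply contDiffOn_snd
  exact ((contDiffOn_bilinearComp hB₁ _ _).add (contDiffOn_bilinearComp hB₀ _ _)).add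
    (contDiffOn_bilinearComp hB₀ _ _)

theorem hasDerivAt_add_smul (e ε : E) (τ : ℝ) : HasDerivAt (fun τ : ℝ => e + τ • ε) ε τ := by
  simpa using ((hasDerivAt_id τ).smul_const ε).const_add e

theorem hasDerivAt_apply_apply {y η : Y} {τ : ℝ} (hB : DifferentiableAt ℝ B (y + τ • η))
    (e ε : E) : HasDerivAt (fun τ : ℝ => B (y + τ • η) (e + τ • ε) (e + τ • ε))
      (prolong B (y + τ • η, η) (e + τ • ε, ε) (e + τ • ε, ε)) τ := by
  have he := hasDerivAt_add_smul e ε τ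
  have hBy := hB.hasFDerivAt.comp_hasDerivAt τ (hasDerivAt_add_smul y η τ)
  refine ((hBy.clm_apply he).clm_apply he).congr_deriv ?_
  simp only [prolong_apply_apply, add_apply, Function.comp_apply]

end Prolongation

section QuadraticIntegral

set_option maxSynthPendingDepth 3

variable {X Y E : Type*} [MeasurableSpace X] {ν : Measure X}
  [NormedAddCommGroup Y] [NormedAddCommGroup E]
  {U K L : Set Y} {y η : X → Y} {e ε : X → E}

/-- The data `(y, e)` at which a quadratic integral `∫ B (y x) (e x) (e x) ∂ν` is evaluated: base
points `y x` in `K`, which is to be a compact subset of the domain of smoothness of `B`, and a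
square integrable `e`. -/
structure IsAdmissible (ν : Measure X) (K : Set Y) (y : X → Y) (e : X → E) : Prop where
  aestronglyMeasurable : AEStronglyMeasurable y ν
  ae_mem : ∀ᵐ x ∂ν, y x ∈ K
  memLp : MemLp e 2 ν

theorem IsAdmissible.prodMk (h : IsAdmissible ν K y e) (h' : IsAdmissible ν L η ε) :
    IsAdmissible ν (K ×ˢ L) (fun x => (y x, η x)) (fun x => (e x, ε x)) where
  aestronglyMeasurable := h.aestronglyMeasurable.prodMk h'.aestronglyMeasurable
  ae_mem := h.ae_mem.and h'.ae_mem
  memLp := MemLp.of_fst_snd ⟨h.memLp, h'.memLp⟩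

theorem isAdmissible_zero (ν : Measure X) :
    IsAdmissible ν {(0 : Y)} (fun _ => 0) (fun _ => (0 : E)) where
  aestronglyMeasurable := aestronglyMeasurable_const
  ae_mem := .of_forall fun _ => rfl
  memLp := .zero'

theorem IsAdmissible.integrable_norm_sq (h : IsAdmissible ν K y e) :
    Integrable (fun x => ‖e x‖ ^ 2) ν :=
  h.memLp.norm.integrable_sq

theorem integral_norm_prodMk_sq_le {F : Type*} [NormedAddCommGroup F] {ε : X → F}
    (he : MemLp e 2 ν) (hε : MemLp ε 2 ν) :
    ∫ x, ‖(e x, ε x)‖ ^ 2 ∂ν ≤ ∫ x, ‖e x‖ ^ 2 ∂ν + ∫ x, ‖ε x‖ ^ 2 ∂ν := by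
  have he2 := he.norm.integrable_sq
  have hε2 := hε.norm.integrable_sq
  rw [← integral_add he2 hε2]
  refine integral_mono_of_nonneg (.of_forall fun x => sq_nonneg _) (he2.add hε2)
    (.of_forall fun x => ?_)
  rcases max_choice ‖e x‖ ‖ε x‖ with hmax | hmax <;>
    simp only [Prod.norm_mk, hmax, le_add_iff_nonneg_left, le_add_iff_nonneg_right,
      sq_nonneg]

theorem IsAdmissible.aestronglyMeasurable_comp {Z : Type*} [TopologicalSpace Z]
    [TopologicalSpace.PseudoMetrizableSpace Z] {f : Y → Z} (h : IsAdmissible ν K y e)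
    (hK : IsCompact K) (hf : ContinuousOn f K) : AEStronglyMeasurable (fun x => f (y x)) ν := by
  borelize Y
  have hy : AEMeasurable y ν := h.aestronglyMeasurable.aemeasurable
  have hfK : AEStronglyMeasurable f ((ν.map y).restrict K) :=
    hf.aestronglyMeasurable_of_isCompact hK hK.measurableSet
  rw [Measure.restrict_eq_self_of_ae_mem ((ae_map_iff hy hK.measurableSet).2 h.ae_mem)] at hfK
  exact hfK.comp_aemeasurable hy

variable [NormedSpace ℝ E] {B : Y → E →L[ℝ] E →L[ℝ] ℝ}

theorem norm_apply_apply_self_le {c : ℝ} {b : E →L[ℝ] E →L[ℝ] ℝ} (hb : ‖b‖ ≤ c) (v : E) :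
    ‖b v v‖ ≤ c * ‖v‖ ^ 2 := by
  calc ‖b v v‖ ≤ ‖b‖ * ‖v‖ * ‖v‖ := b.le_opNorm₂ v v
    _ ≤ c * ‖v‖ * ‖v‖ := by gcongr
    _ = c * ‖v‖ ^ 2 := by ring

theorem IsAdmissible.integrable_apply_apply (h : IsAdmissible ν K y e) (hK : IsCompact K)
    (hB : ContinuousOn B K) : Integrable (fun x => B (y x) (e x) (e x)) ν := by
  obtain ⟨c, hc⟩ := hK.exists_bound_of_continuousOn hB
  have hBe : AEStronglyMeasurable (fun x => B (y x) (e x)) ν :=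
    (ContinuousLinearMap.id ℝ (E →L[ℝ] E →L[ℝ] ℝ)).aestronglyMeasurable_comp₂
      (h.aestronglyMeasurable_comp hK hB) h.memLp.1
  refine (h.integrable_norm_sq.const_mul c).mono'
    ((ContinuousLinearMap.id ℝ (E →L[ℝ] ℝ)).aestronglyMeasurable_comp₂ hBe h.memLp.1) ?_
  filter_upwards [h.ae_mem] with x hx using norm_apply_apply_self_le (hc _ hx) _

theorem IsAdmissible.abs_integral_apply_apply_le (h : IsAdmissible ν K y e) {c : ℝ}
    (hc : ∀ z ∈ K, ‖B z‖ ≤ c) :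
    |∫ x, B (y x) (e x) (e x) ∂ν| ≤ c * ∫ x, ‖e x‖ ^ 2 ∂ν := by
  rw [← integral_const_mul, ← Real.norm_eq_abs]
  refine norm_integral_le_of_norm_le (h.integrable_norm_sq.const_mul c) ?_
  filter_upwards [h.ae_mem] with x hx using norm_apply_apply_self_le (hc _ hx) _

variable [NormedSpace ℝ Y]

theorem IsAdmissible.add_smul {K' : Set Y} {τ : ℝ} (h : IsAdmissible ν K y e)
    (h' : IsAdmissible ν L η ε) (hτ : ∀ z ∈ K ×ˢ L, z.1 + τ • z.2 ∈ K') :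
    IsAdmissible ν K' (fun x => y x + τ • η x) (fun x => e x + τ • ε x) where
  aestronglyMeasurable := h.aestronglyMeasurable.add (h'.aestronglyMeasurable.const_smul τ)
  ae_mem := by filter_upwards [h.ae_mem, h'.ae_mem] with x hy hη using hτ (y x, η x) ⟨hy, hη⟩
  memLp := h.memLp.add (h'.memLp.const_smul τ)

theorem exists_isCompact_eventually_add_smul_mem (hU : IsOpen U) (hK : IsCompact K)
    (hKU : K ⊆ U) (hL : IsCompact L) :
    ∃ K' ⊆ U, IsCompact K' ∧ ∀ᶠ τ : ℝ in 𝓝 0, ∀ z ∈ K ×ˢ L, z.1 + τ • z.2 ∈ K' := by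
  let f : ℝ × Y × Y → Y := fun q => q.2.1 + q.1 • q.2.2
  have hf : Continuous f := by fun_prop
  have htube : ∀ᶠ τ : ℝ in 𝓝 0, ∀ z ∈ K ×ˢ L, f (τ, z) ∈ U := by
    refine (hK.prod hL).eventually_forall_of_forall_eventually fun z hz => ?_
    exact hf.continuousAt.eventually (hU.mem_nhds (by simpa [f] using hKU hz.1))
  obtain ⟨δ, hδ, hδU⟩ := Metric.nhds_basis_closedBall.mem_iff.1 htube
  refine ⟨f '' (Metric.closedBall 0 δ ×ˢ K ×ˢ L), ?_,
    ((isCompact_closedBall 0 δ).prod (hK.prod hL)).image hf, ?_⟩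
  · rintro _ ⟨q, hq, rfl⟩
    exact hδU hq.1 q.2 hq.2
  · filter_upwards [Metric.closedBall_mem_nhds 0 hδ] with τ hτ z hz using
      ⟨(τ, z), ⟨hτ, hz⟩, rfl⟩

theorem norm_add_smul_prodMk_le {τ : ℝ} (hτ : |τ| ≤ 1) (v w : E) :
    ‖(v + τ • w, w)‖ ≤ ‖v‖ + ‖w‖ := by
  refine max_le ((norm_add_le _ _).trans ?_) (le_add_of_nonneg_left (norm_nonneg v))
  rw [norm_smul]
  gcongr
  exact mul_le_of_le_one_left (norm_nonneg w) hτ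

theorem IsAdmissible.hasDerivAt_integral_apply_apply (h : IsAdmissible ν K y e)
    (h' : IsAdmissible ν L η ε) (hK : IsCompact K) (hL : IsCompact L) (hKU : K ⊆ U)
    (hU : IsOpen U) (hB : ContDiffOn ℝ 1 B U) :
    HasDerivAt (fun τ : ℝ => ∫ x, B (y x + τ • η x) (e x + τ • ε x) (e x + τ • ε x) ∂ν)
      (∫ x, prolong B (y x, η x) (e x, ε x) (e x, ε x) ∂ν) 0 := by
  obtain ⟨K', hK'U, hK', hev⟩ := exists_isCompact_eventually_add_smul_mem hU hK hKU hL
  have hBK' : ContinuousOn B K' := hB.continuousOn.mono hK'U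
  have hprolong : ContinuousOn (prolong B) (U ×ˢ univ) :=
    (contDiffOn_prolong (k := 0) hU (by simpa using hB)).continuousOn
  obtain ⟨c, hc⟩ := (hK'.prod hL).exists_bound_of_continuousOn
    (hprolong.mono (prod_mono hK'U (subset_univ L)))
  have hint : ∀ᶠ τ : ℝ in 𝓝 0,
      Integrable (fun x => B (y x + τ • η x) (e x + τ • ε x) (e x + τ • ε x)) ν :=
    hev.mono fun τ hτ => (h.add_smul h' hτ).integrable_apply_apply hK' hBK'
  have hprolong_int : Integrable (fun x => prolong B (y x, η x) (e x, ε x) (e x, ε x)) ν :=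
    (h.prodMk h').integrable_apply_apply (hK.prod hL)
      (hprolong.mono (prod_mono hKU (subset_univ L)))
  have hsmall : ∀ᶠ τ : ℝ in 𝓝 0, |τ| ≤ 1 := by
    filter_upwards [Metric.closedBall_mem_nhds (0 : ℝ) one_pos] with τ hτ using by simpa using hτ
  have key := hasDerivAt_integral_of_dominated_loc_of_deriv_le (μ := ν)
    (F' := fun τ x => prolong B (y x + τ • η x, η x) (e x + τ • ε x, ε x) (e x + τ • ε x, ε x))
    (bound := fun x => c * (‖e x‖ + ‖ε x‖) ^ 2) (hev.and hsmall)
    (hint.mono fun τ hτ => hτ.aestronglyMeasurable) hint.self_of_nhds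
    (by simpa using hprolong_int.aestronglyMeasurable) ?_
    ((h.memLp.norm.add h'.memLp.norm).integrable_sq.const_mul c) ?_
  · simpa using key.2
  · filter_upwards [h.ae_mem, h'.ae_mem] with x hy hη τ hτ
    have hcx : ‖prolong B (y x + τ • η x, η x)‖ ≤ c := hc _ ⟨hτ.1 (y x, η x) ⟨hy, hη⟩, hη⟩
    refine (norm_apply_apply_self_le hcx _).trans ?_
    have hc₀ : 0 ≤ c := (norm_nonneg _).trans hcx
    gcongr
    exact norm_add_smul_prodMk_le hτ.2 _ _
  · filter_upwards [h.ae_mem, h'.ae_mem] with x hy hη τ hτ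
    have hmem : y x + τ • η x ∈ U := hK'U (hτ.1 (y x, η x) ⟨hy, hη⟩)
    exact hasDerivAt_apply_apply
      ((hB.differentiableOn one_ne_zero).differentiableAt (hU.mem_nhds hmem)) _ _

theorem IsAdmissible.eventually_integrable_apply_apply (h : IsAdmissible ν K y e)
    (h' : IsAdmissible ν L η ε) (hK : IsCompact K) (hL : IsCompact L) (hKU : K ⊆ U)
    (hU : IsOpen U) (hB : ContinuousOn B U) :
    ∀ᶠ τ : ℝ in 𝓝 0,
      Integrable (fun x => B (y x + τ • η x) (e x + τ • ε x) (e x + τ • ε x)) ν := by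
  obtain ⟨K', hK'U, hK', hev⟩ := exists_isCompact_eventually_add_smul_mem hU hK hKU hL
  exact hev.mono fun τ hτ => (h.add_smul h' hτ).integrable_apply_apply hK' (hB.mono hK'U)

end QuadraticIntegral

section Average

variable {E : Type*} [NormedAddCommGroup E] [NormedSpace ℝ E]

/-- The average of the derivative of `f` between `u` and `u + v`. -/
noncomputable def avg (f : ℝ → E) (u v : ℝ) : E := ∫ θ in (0 : ℝ)..1, deriv f (u + θ * v)

theorem avg_zero [CompleteSpace E] (f : ℝ → E) (u : ℝ) : avg f u 0 = deriv f u := by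
  simp [avg]

variable {f h : ℝ → E}

theorem continuous_deriv_comp_segment (hf : ContDiff ℝ 1 f) (u v : ℝ) :
    Continuous fun θ : ℝ => deriv f (u + θ * v) :=
  (hf.continuous_deriv le_rfl).comp (by fun_prop)

theorem smul_avg [CompleteSpace E] (hf : ContDiff ℝ 1 f) (u v : ℝ) :
    v • avg f u v = f (u + v) - f u := by
  have h1 : ∀ θ ∈ uIcc (0 : ℝ) 1, HasDerivAt (fun θ : ℝ => f (u + θ * v))
      (v • deriv f (u + θ * v)) θ := by
    intro θ _
    have hl : HasDerivAt (fun θ : ℝ => u + θ * v) v θ := by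
      simpa using ((hasDerivAt_id θ).mul_const v).const_add u
    exact ((hf.differentiable one_ne_zero) (u + θ * v)).hasDerivAt.scomp θ hl
  have h2 := intervalIntegral.integral_eq_sub_of_hasDerivAt h1
    (((continuous_deriv_comp_segment hf u v).const_smul v).intervalIntegrable _ _)
  rw [intervalIntegral.integral_smul] at h2
  simpa [avg] using h2

theorem continuous_avg (hf : ContDiff ℝ 1 f) : Continuous fun x : ℝ × ℝ => avg f x.1 x.2 := by
  unfold avg
  refine intervalIntegral.continuous_parametric_intervalIntegral_of_continuous' ?_ _ _
  exact (hf.continuous_deriv le_rfl).comp (by fun_prop)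

theorem norm_avg_le {M : ℝ} (hM : ∀ u, ‖deriv f u‖ ≤ M) (u v : ℝ) : ‖avg f u v‖ ≤ M := by
  have := intervalIntegral.norm_integral_le_of_norm_le_const (a := (0 : ℝ)) (b := 1)
    (f := fun θ => deriv f (u + θ * v)) (C := M) fun θ _ => hM _
  simpa [avg] using this

theorem deriv_add_smul (hf : ContDiff ℝ 1 f) (hh : ContDiff ℝ 1 h) (τ u : ℝ) :
    deriv (f + τ • h) u = deriv f u + τ • deriv h u := by
  have h1 := hf.differentiable one_ne_zero u
  have h2 := hh.differentiable one_ne_zero u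
  rw [deriv_add h1 (h2.const_smul τ), deriv_const_smul_field]

theorem avg_add_smul (hf : ContDiff ℝ 1 f) (hh : ContDiff ℝ 1 h) (τ u v : ℝ) :
    avg (f + τ • h) u v = avg f u v + τ • avg h u v := by
  unfold avg
  rw [← intervalIntegral.integral_smul, ← intervalIntegral.integral_add
    (g := fun θ => τ • deriv h (u + θ * v))
    ((continuous_deriv_comp_segment hf u v).intervalIntegrable _ _)
    (((continuous_deriv_comp_segment hh u v).const_smul τ).intervalIntegrable _ _)]
  simp_rw [deriv_add_smul hf hh]

theorem periodic_deriv (hf : Function.Periodic f 1) : Function.Periodic (deriv f) 1 := by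
  intro u
  rw [← deriv_comp_add_const]
  congr 1
  exact funext hf

/-- The representative of `t` modulo `1` of smallest modulus. -/
noncomputable def circRep (t : ℝ) : ℝ := t - round t

theorem abs_circRep (t : ℝ) : |circRep t| = ‖(t : UnitAddCircle)‖ := UnitAddCircle.norm_eq.symm

theorem measurable_circRep : Measurable circRep := by
  unfold circRep
  simp_rw [round_eq]
  exact measurable_id.sub (measurable_from_top.comp
    (Int.measurable_floor.comp (measurable_id.add_const _)))

theorem periodic_apply_add_circRep {α : Type*} {f : ℝ → α} (hf : Function.Periodic f 1)
    (u v w : ℝ) : f (u + w + circRep (v - w)) = f (u + v) := by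
  have := hf.sub_zsmul_eq (x := u + v) (round (v - w))
  rw [← this]
  congr 1
  simp [circRep]; ring

/-- The first-order data of the curve `f` at the triple `(u, u + v, u + w)`. -/
noncomputable def jet (f : ℝ → E) (x : ℝ × ℝ × ℝ) : Fin 6 → E :=
  ![avg f x.1 x.2.1, avg f x.1 x.2.2, avg f (x.1 + x.2.2) (circRep (x.2.1 - x.2.2)),
    deriv f x.1, deriv f (x.1 + x.2.1), deriv f (x.1 + x.2.2)]

/-- The difference of the two averages of the derivative of `f` issuing from `u`. -/
noncomputable def defect (f : ℝ → E) (x : ℝ × ℝ × ℝ) : E := avg f x.1 x.2.2 - avg f x.1 x.2.1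

theorem jet_add_smul (hf : ContDiff ℝ 1 f) (hh : ContDiff ℝ 1 h) (τ : ℝ) (x : ℝ × ℝ × ℝ) :
    jet (f + τ • h) x = jet f x + τ • jet h x := by
  simp only [jet, avg_add_smul hf hh, deriv_add_smul hf hh]
  ext i; fin_cases i <;> rfl

theorem defect_add_smul (hf : ContDiff ℝ 1 f) (hh : ContDiff ℝ 1 h) (τ : ℝ) (x : ℝ × ℝ × ℝ) :
    defect (f + τ • h) x = defect f x + τ • defect h x := by
  simp only [defect, avg_add_smul hf hh]
  module

theorem norm_jet_le {M : ℝ} (hM : ∀ u, ‖deriv f u‖ ≤ M) (x : ℝ × ℝ × ℝ) : ‖jet f x‖ ≤ M := by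
  have hM0 : 0 ≤ M := (norm_nonneg _).trans (hM 0)
  rw [pi_norm_le_iff_of_nonneg hM0]
  intro i
  fin_cases i
  · exact norm_avg_le hM _ _
  · exact norm_avg_le hM _ _
  · exact norm_avg_le hM _ _
  · exact hM _
  · exact hM _
  · exact hM _

theorem measurable_jet [MeasurableSpace E] [BorelSpace E] (hf : ContDiff ℝ 1 f) :
    Measurable (jet f) := by
  have hd := (hf.continuous_deriv le_rfl).measurable
  have ha := (continuous_avg hf).measurable
  rw [measurable_pi_iff]
  intro i
  fin_cases i
  · exact ha.comp (measurable_fst.prodMk measurable_snd.fst)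
  · exact ha.comp (measurable_fst.prodMk measurable_snd.snd)
  · exact ha.comp ((measurable_fst.add measurable_snd.snd).prodMk
      (measurable_circRep.comp (measurable_snd.fst.sub measurable_snd.snd)))
  · exact hd.comp measurable_fst
  · exact hd.comp (measurable_fst.add measurable_snd.fst)
  · exact hd.comp (measurable_fst.add measurable_snd.snd)

theorem continuous_defect (hf : ContDiff ℝ 1 f) : Continuous (defect f) := by
  have ha := continuous_avg hf
  exact (ha.comp (f := fun x : ℝ × ℝ × ℝ => (x.1, x.2.2)) (by fun_prop)).sub
    (ha.comp (f := fun x : ℝ × ℝ × ℝ => (x.1, x.2.1)) (by fun_prop))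

end Average

section Form

variable {n : ℕ}

/-- The exterior product as a continuous bilinear map. -/
noncomputable def wedgeL (n : ℕ) : EuclideanSpace ℝ (Fin n) →L[ℝ] EuclideanSpace ℝ (Fin n) →L[ℝ]
    EuclideanSpace ℝ {ij : Fin n × Fin n // ij.1 < ij.2} :=
  LinearMap.toContinuousBilinearMap (LinearMap.mk₂ ℝ wedge
    (fun a b c => by ext; simp [wedge]; ring) (fun r a b => by ext; simp [wedge]; ring)
    (fun a b c => by ext; simp [wedge]; ring) (fun r a b => by ext; simp [wedge]; ring))

theorem wedgeL_apply (a b : EuclideanSpace ℝ (Fin n)) : wedgeL n a b = wedge a b := rfl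

theorem wedge_sub_self (a b : EuclideanSpace ℝ (Fin n)) : wedge a (b - a) = wedge a b := by
  ext; simp [wedge]; ring

theorem norm_wedge_smul_smul (a b : EuclideanSpace ℝ (Fin n)) (r t : ℝ) :
    ‖wedge (r • a) (t • b)‖ = |r| * |t| * ‖wedge a b‖ := by
  simp only [← wedgeL_apply, map_smul, smul_apply, norm_smul, Real.norm_eq_abs]
  ring

/-- The scalar factor of `mengerForm`. -/
noncomputable def mengerFactor (p : ℝ) (y : Fin 6 → EuclideanSpace ℝ (Fin n)) : ℝ :=
  ‖y 3‖ * ‖y 4‖ * ‖y 5‖ * (‖y 0‖ * ‖y 1‖ * ‖y 2‖) ^ (-p)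

/-- The bilinear form through which the integrand of the energy depends on the defect of the
curve; its coefficients are functions of the jet of the curve, see `mengerIntegrand_eq`. -/
noncomputable def mengerForm (p : ℝ) (y : Fin 6 → EuclideanSpace ℝ (Fin n)) :
    EuclideanSpace ℝ (Fin n) →L[ℝ] EuclideanSpace ℝ (Fin n) →L[ℝ] ℝ :=
  mengerFactor p y • (innerSL ℝ).bilinearComp (wedgeL n (y 0)) (wedgeL n (y 0))

theorem mengerForm_apply (p : ℝ) (y : Fin 6 → EuclideanSpace ℝ (Fin n))
    (e e' : EuclideanSpace ℝ (Fin n)) :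
    mengerForm p y e e' = mengerFactor p y * inner ℝ (wedgeL n (y 0) e) (wedgeL n (y 0) e') := rfl

theorem mengerForm_self (p : ℝ) (y : Fin 6 → EuclideanSpace ℝ (Fin n))
    (e : EuclideanSpace ℝ (Fin n)) :
    mengerForm p y e e = mengerFactor p y * ‖wedge (y 0) e‖ ^ 2 := by
  rw [mengerForm_apply, real_inner_self_eq_norm_sq, wedgeL_apply]

theorem mengerForm_self_nonneg (p : ℝ) (y : Fin 6 → EuclideanSpace ℝ (Fin n))
    (e : EuclideanSpace ℝ (Fin n)) : 0 ≤ mengerForm p y e e := by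
  rw [mengerForm_self, mengerFactor]
  positivity

/-- The jets without vanishing entry, on which `mengerForm` is smooth. -/
def regularSet (n : ℕ) : Set (Fin 6 → EuclideanSpace ℝ (Fin n)) := {y | ∀ i, y i ≠ 0}

theorem isOpen_regularSet : IsOpen (regularSet n) := by
  simp only [regularSet, ofPred_forall]
  exact isOpen_iInter_of_finite fun i => isOpen_ne_fun (continuous_apply i) continuous_const

theorem contDiffOn_mengerFactor (p : ℝ) {k : WithTop ℕ∞} :
    ContDiffOn ℝ k (mengerFactor (n := n) p) (regularSet n) := by
  intro y hy
  have hnorm (i : Fin 6) : ContDiffAt ℝ k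
      (fun y : Fin 6 → EuclideanSpace ℝ (Fin n) => ‖y i‖) y :=
    (contDiff_apply ℝ _ i).contDiffAt.norm ℝ (hy i)
  have hne (i : Fin 6) : ‖y i‖ ≠ 0 := norm_ne_zero_iff.2 (hy i)
  exact ((((hnorm 3).mul (hnorm 4)).mul (hnorm 5)).mul
    ((((hnorm 0).mul (hnorm 1)).mul (hnorm 2)).rpow_const_of_ne
      (mul_ne_zero (mul_ne_zero (hne 0) (hne 1)) (hne 2)))).contDiffWithinAt

theorem contDiffOn_mengerForm (p : ℝ) {k : WithTop ℕ∞} :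
    ContDiffOn ℝ k (mengerForm (n := n) p) (regularSet n) := by
  refine contDiffOn_clm_apply.2 fun e => contDiffOn_clm_apply.2 fun e' => ?_
  simp only [mengerForm_apply]
  refine (contDiffOn_mengerFactor p).mul (ContDiff.contDiffOn ?_)
  exact ContDiff.inner ℝ (by fun_prop) (by fun_prop)

/-- The kernel of the energy in the coordinates `(u, u + v, u + w)`. For `p ≠ 0, 2` it vanishes
where two of these points coincide, since `0 ^ r = 0` for all `r ≠ 0`. -/
noncomputable def kern (p v w : ℝ) : ℝ :=
  |v| ^ (2 - p) * |w| ^ (2 - p) * |circRep (v - w)| ^ (-p)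

theorem kern_nonneg (p v w : ℝ) : 0 ≤ kern p v w := by unfold kern; positivity

theorem abs_rpow_two_sub {p : ℝ} (hp : p ≠ 2) (v : ℝ) : |v| ^ (2 - p) = |v| ^ 2 * |v| ^ (-p) := by
  rcases eq_or_ne v 0 with rfl | hv
  · simp [Real.zero_rpow (sub_ne_zero.2 hp.symm)]
  · rw [sub_eq_add_neg, Real.rpow_add (abs_pos.2 hv), Real.rpow_two]

theorem invR_rotate (p q : ℝ) (x y z : EuclideanSpace ℝ (Fin n)) :
    invR p q y z x = invR p q x y z := by
  have hwedge : wedge (z - y) (x - y) = wedge (y - x) (z - x) := by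
    ext; simp [wedge]; ring
  rw [invR, invR, hwedge, norm_sub_rev z y, norm_sub_rev x y]
  congr 2
  ring

/-- The integrand of the Menger energy `menger p 2`. -/
noncomputable def mengerIntegrand (p : ℝ) (γ : ℝ → EuclideanSpace ℝ (Fin n)) (x : ℝ × ℝ × ℝ) : ℝ :=
  ‖deriv γ x.1‖ * ‖deriv γ x.2.1‖ * ‖deriv γ x.2.2‖ * invR p 2 (γ x.1) (γ x.2.1) (γ x.2.2)

theorem mengerIntegrand_rotate (p : ℝ) (γ : ℝ → EuclideanSpace ℝ (Fin n)) (x y z : ℝ) :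
    mengerIntegrand p γ (y, z, x) = mengerIntegrand p γ (x, y, z) := by
  simp only [mengerIntegrand, invR_rotate p 2 (γ x)]
  ring

theorem mengerIntegrand_eq {p : ℝ} (hp : p ≠ 2) {γ : ℝ → EuclideanSpace ℝ (Fin n)}
    (hγ : ContDiff ℝ 1 γ) (hper : Function.Periodic γ 1) (u v w : ℝ) :
    mengerIntegrand p γ (u, u + v, u + w) =
      kern p v w * mengerForm p (jet γ (u, v, w)) (defect γ (u, v, w)) (defect γ (u, v, w)) := by
  have hv := smul_avg hγ u v
  have hw := smul_avg hγ u w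
  have hvw := smul_avg hγ (u + w) (circRep (v - w))
  rw [periodic_apply_add_circRep hper] at hvw
  have hrpow {a b c a' b' c' : ℝ} (ha : 0 ≤ a) (hb : 0 ≤ b) (hc : 0 ≤ c) (ha' : 0 ≤ a')
      (hb' : 0 ≤ b') (hc' : 0 ≤ c') : (a * a' * (b * b') * (c * c')) ^ (-p) =
        a ^ (-p) * b ^ (-p) * c ^ (-p) * (a' * b' * c') ^ (-p) := by
    rw [← Real.mul_rpow ha hb, ← Real.mul_rpow (by positivity) hc,
      ← Real.mul_rpow (by positivity) (by positivity)]
    ring_nf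
  simp only [mengerIntegrand, invR, ← hv, ← hw, ← hvw, norm_wedge_smul_smul, norm_smul,
    Real.norm_eq_abs, mengerForm_self, mengerFactor, kern, abs_rpow_two_sub hp, jet, defect,
    Matrix.cons_val, wedge_sub_self, Real.rpow_two, div_eq_mul_inv]
  rw [← Real.rpow_neg (by positivity), hrpow (abs_nonneg _) (abs_nonneg _) (abs_nonneg _)
    (norm_nonneg _) (norm_nonneg _) (norm_nonneg _)]
  ring

theorem measurable_mengerIntegrand (p : ℝ) {γ : ℝ → EuclideanSpace ℝ (Fin n)}
    (hγ : ContDiff ℝ 1 γ) : Measurable (mengerIntegrand p γ) := by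
  have hd := (hγ.continuous_deriv le_rfl).measurable
  have hc := hγ.continuous.measurable
  have hx : Measurable fun x : ℝ × ℝ × ℝ => γ x.1 := hc.comp measurable_fst
  have hy : Measurable fun x : ℝ × ℝ × ℝ => γ x.2.1 := hc.comp measurable_snd.fst
  have hz : Measurable fun x : ℝ × ℝ × ℝ => γ x.2.2 := hc.comp measurable_snd.snd
  have hwedge : Measurable fun x : ℝ × ℝ × ℝ =>
      wedge (γ x.2.1 - γ x.1) (γ x.2.2 - γ x.1) :=
    (wedgeL n).continuous₂.measurable.comp ((hy.sub hx).prodMk (hz.sub hx))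
  unfold mengerIntegrand invR
  refine Measurable.mul (Measurable.mul (Measurable.mul ?_ ?_) ?_)
    ((hwedge.norm.pow_const _).div ?_)
  · exact (hd.comp measurable_fst).norm
  · exact (hd.comp measurable_snd.fst).norm
  · exact (hd.comp measurable_snd.snd).norm
  · exact (((hy.sub hx).norm.mul (hz.sub hx).norm).mul (hy.sub hz).norm).pow_const _

end Form

section Symmetrization

variable {α : Type*} [MeasurableSpace α]

/-- The cyclic rotation of a triple. -/
def rotate (x : α × α × α) : α × α × α := (x.2.1, x.2.2, x.1)

theorem measurePreserving_rotate (μ : Measure α) [SFinite μ] :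
    MeasurePreserving rotate (μ.prod (μ.prod μ)) (μ.prod (μ.prod μ)) :=
  (measurePreserving_prodAssoc μ μ μ).comp Measure.measurePreserving_swap

theorem lintegral_eq_three_mul_lintegral_mul {μ : Measure α} [SFinite μ]
    {Φ θ : α × α × α → ℝ≥0∞} (hΦ : Measurable Φ) (hθ : Measurable θ)
    (hrot : ∀ x, Φ (rotate x) = Φ x)
    (hsum : ∀ x, Φ x * (θ x + θ (rotate x) + θ (rotate (rotate x))) = Φ x) :
    ∫⁻ x, Φ x ∂μ.prod (μ.prod μ) = 3 * ∫⁻ x, Φ x * θ x ∂μ.prod (μ.prod μ) := by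
  have hρ := measurePreserving_rotate μ
  have hrotate : Measurable (rotate : α × α × α → α × α × α) := hρ.measurable
  have hΦθ : Measurable fun x => Φ x * θ x := hΦ.mul hθ
  have hΦθ' : Measurable fun x => Φ x * θ (rotate x) := hΦ.mul (hθ.comp hrotate)
  have hinv : ∫⁻ x, Φ x * θ (rotate x) ∂μ.prod (μ.prod μ) =
      ∫⁻ x, Φ x * θ x ∂μ.prod (μ.prod μ) := by
    simpa only [hrot] using hρ.lintegral_comp hΦθ
  have hinv' : ∫⁻ x, Φ x * θ (rotate (rotate x)) ∂μ.prod (μ.prod μ) =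
      ∫⁻ x, Φ x * θ (rotate x) ∂μ.prod (μ.prod μ) := by
    simpa only [hrot] using hρ.lintegral_comp hΦθ'
  calc ∫⁻ x, Φ x ∂μ.prod (μ.prod μ)
      = ∫⁻ x, (Φ x * θ x + Φ x * θ (rotate x) + Φ x * θ (rotate (rotate x)))
          ∂μ.prod (μ.prod μ) := by simp only [← mul_add, hsum]
    _ = 3 * ∫⁻ x, Φ x * θ x ∂μ.prod (μ.prod μ) := by
      rw [lintegral_add_left (by fun_prop), lintegral_add_left hΦθ, hinv', hinv]
      ring

/-- The weight of the vertex `x` of a triangle with vertices `x, y, z` modulo `1`: it is large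
when the side opposite to `x` is, and the weights of the three vertices add up to `1` unless all
sides vanish. -/
noncomputable def share (p : ℝ) (x : ℝ × ℝ × ℝ) : ℝ :=
  |circRep (x.2.1 - x.2.2)| ^ p /
    (|circRep (x.2.1 - x.2.2)| ^ p + |circRep (x.2.2 - x.1)| ^ p + |circRep (x.1 - x.2.1)| ^ p)

theorem share_nonneg (p : ℝ) (x : ℝ × ℝ × ℝ) : 0 ≤ share p x := by unfold share; positivity

theorem measurable_share (p : ℝ) : Measurable (share p) := by
  have h {f : ℝ × ℝ × ℝ → ℝ} (hf : Measurable f) : Measurable fun x => |circRep (f x)| ^ p :=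
    ((measurable_circRep.comp hf).abs).pow_const p
  have hyz := h (f := fun x => x.2.1 - x.2.2) (by fun_prop)
  exact hyz.div ((hyz.add (h (f := fun x => x.2.2 - x.1) (by fun_prop))).add
    (h (f := fun x => x.1 - x.2.1) (by fun_prop)))

theorem share_add_share_add_share (p : ℝ) {x : ℝ × ℝ × ℝ} (hx : circRep (x.1 - x.2.1) ≠ 0) :
    share p x + share p (rotate x) + share p (rotate (rotate x)) = 1 := by
  have hpos : 0 < |circRep (x.1 - x.2.1)| ^ p := Real.rpow_pos_of_pos (abs_pos.2 hx) p
  simp only [share, rotate]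
  generalize |circRep (x.1 - x.2.1)| ^ p = c at hpos ⊢
  have ha : 0 ≤ |circRep (x.2.1 - x.2.2)| ^ p := by positivity
  have hb : 0 ≤ |circRep (x.2.2 - x.1)| ^ p := by positivity
  generalize |circRep (x.2.1 - x.2.2)| ^ p = a at ha ⊢
  generalize |circRep (x.2.2 - x.1)| ^ p = b at hb ⊢
  rw [show b + c + a = a + b + c by ring, show c + a + b = a + b + c by ring]
  field_simp

theorem circRep_add_one (t : ℝ) : circRep (t + 1) = circRep t := by
  simp [circRep]

theorem circRep_sub_one (t : ℝ) : circRep (t - 1) = circRep t := by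
  rw [← circRep_add_one (t - 1), sub_add_cancel]

theorem share_add_left (p u v w : ℝ) : share p (u, u + v, u + w) = share p (0, v, w) := by
  simp [share]

theorem periodic_share_snd (p x z : ℝ) : Function.Periodic (fun y => share p (x, y, z)) 1 := by
  intro y
  simp only [share, add_sub_right_comm, circRep_add_one, ← sub_sub, circRep_sub_one]

theorem periodic_share_thd (p x y : ℝ) : Function.Periodic (fun z => share p (x, y, z)) 1 := by
  intro z
  simp only [share, add_sub_right_comm, circRep_add_one, ← sub_sub, circRep_sub_one]

/-- Lebesgue measure on the representatives of `ℝ/ℤ` of smallest modulus. -/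
noncomputable def centralMeasure : Measure ℝ := volume.restrict (Ioc (-(1 / 2)) (1 / 2))

instance : IsFiniteMeasure centralMeasure := by
  unfold centralMeasure; infer_instance

theorem lintegral_Ioc_eq_centralMeasure {H : ℝ → ℝ≥0∞} (hH : Function.Periodic H 1) (u : ℝ) :
    ∫⁻ x in Ioc (0 : ℝ) 1, H x = ∫⁻ v, H (u + v) ∂centralMeasure := by
  have hshift : ∫⁻ x in Ioc (0 : ℝ) 1, H x = ∫⁻ x in Ioc (u - 1 / 2) (u + 1 / 2), H x := by
    have h := lintegral_Ioc_periodic hH 0 (u - 1 / 2)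
    rwa [zero_add, show u - 1 / 2 + 1 = u + 1 / 2 by ring] at h
  rw [hshift, centralMeasure, ← (measurePreserving_add_left volume u).setLIntegral_comp_preimage_emb
    (measurableEmbedding_addLeft u), preimage_const_add_Ioc]
  congr 3 <;> ring

/-- The measure on the triples `(u, v, w)` that parametrize the points `(u, u + v, u + w)`. -/
noncomputable def baseMeasure : Measure (ℝ × ℝ × ℝ) :=
  (volume.restrict (Ioc (0 : ℝ) 1)).prod (centralMeasure.prod centralMeasure)

theorem lintegral_prod_Ioc_eq_baseMeasure {Ψ : ℝ × ℝ × ℝ → ℝ≥0∞} (hΨ : Measurable Ψ)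
    (hsnd : ∀ x z, Function.Periodic (fun y => Ψ (x, y, z)) 1)
    (hthd : ∀ x y, Function.Periodic (fun z => Ψ (x, y, z)) 1) :
    ∫⁻ x, Ψ x ∂(volume.restrict (Ioc (0 : ℝ) 1)).prod
        ((volume.restrict (Ioc (0 : ℝ) 1)).prod (volume.restrict (Ioc (0 : ℝ) 1))) =
      ∫⁻ x, Ψ (x.1, x.1 + x.2.1, x.1 + x.2.2) ∂baseMeasure := by
  have hΨ' : Measurable fun x : ℝ × ℝ × ℝ => Ψ (x.1, x.1 + x.2.1, x.1 + x.2.2) :=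
    hΨ.comp (by fun_prop)
  rw [baseMeasure, lintegral_prod _ hΨ.aemeasurable, lintegral_prod _ hΨ'.aemeasurable]
  refine lintegral_congr fun u => ?_
  rw [lintegral_prod (fun y => Ψ (u, y)) (by fun_prop),
    lintegral_prod (fun y : ℝ × ℝ => Ψ (u, u + y.1, u + y.2)) (by fun_prop),
    lintegral_Ioc_eq_centralMeasure (fun y => lintegral_congr fun z => hsnd u z y) u]
  exact lintegral_congr fun v => lintegral_Ioc_eq_centralMeasure (hthd u (u + v)) u

end Symmetrization

section Representation

variable {n : ℕ} {p : ℝ} {γ : ℝ → EuclideanSpace ℝ (Fin n)}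

/-- The weight which the kernel of the energy has after the symmetrization of the energy. -/
noncomputable def mengerDensity (p : ℝ) (x : ℝ × ℝ × ℝ) : ℝ :=
  3 * (kern p x.2.1 x.2.2 * share p (0, x.2.1, x.2.2))

theorem mengerDensity_nonneg (p : ℝ) (x : ℝ × ℝ × ℝ) : 0 ≤ mengerDensity p x :=
  mul_nonneg zero_le_three (mul_nonneg (kern_nonneg _ _ _) (share_nonneg _ _))

theorem measurable_mengerDensity (p : ℝ) : Measurable (mengerDensity p) := by
  have hshare : Measurable fun x : ℝ × ℝ × ℝ => share p (0, x.2.1, x.2.2) :=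
    (measurable_share p).comp (by fun_prop)
  have hcirc : Measurable fun x : ℝ × ℝ × ℝ => |circRep (x.2.1 - x.2.2)| :=
    (measurable_circRep.comp (by fun_prop)).abs
  unfold mengerDensity kern
  fun_prop

/-- The measure with respect to which the energy is the integral of `mengerForm`. -/
noncomputable def mengerMeasure (p : ℝ) : Measure (ℝ × ℝ × ℝ) :=
  baseMeasure.withDensity fun x => ENNReal.ofReal (mengerDensity p x)

theorem mengerIntegrand_eq_zero (p : ℝ) (hγ : Function.Periodic γ 1) {x : ℝ × ℝ × ℝ}
    (hx : circRep (x.1 - x.2.1) = 0) : mengerIntegrand p γ x = 0 := by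
  have hround : x.2.1 = x.1 - round (x.1 - x.2.1) := by
    rw [circRep] at hx
    linarith
  have heq : γ x.2.1 = γ x.1 := by
    rw [hround]
    simpa only [mul_one] using hγ.sub_int_mul_eq (round (x.1 - x.2.1))
  simp [mengerIntegrand, invR, heq, ← wedgeL_apply]

theorem menger_eq_lintegral_prod (p : ℝ) (γ : ℝ → EuclideanSpace ℝ (Fin n)) :
    menger p 2 γ = ∫⁻ x, ENNReal.ofReal (mengerIntegrand p γ x)
      ∂(volume.restrict (Ioc (0 : ℝ) 1)).prod
        ((volume.restrict (Ioc (0 : ℝ) 1)).prod (volume.restrict (Ioc (0 : ℝ) 1))) := by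
  rw [Measure.prod_restrict, Measure.prod_restrict, ← Measure.volume_eq_prod,
    ← Measure.volume_eq_prod]
  rfl

theorem menger_eq_lintegral_share (hγ : ContDiff ℝ 1 γ) (hper : Function.Periodic γ 1) (p : ℝ) :
    menger p 2 γ = 3 * ∫⁻ x, ENNReal.ofReal (mengerIntegrand p γ x) * ENNReal.ofReal (share p x)
      ∂(volume.restrict (Ioc (0 : ℝ) 1)).prod
        ((volume.restrict (Ioc (0 : ℝ) 1)).prod (volume.restrict (Ioc (0 : ℝ) 1))) := by
  rw [menger_eq_lintegral_prod]
  refine lintegral_eq_three_mul_lintegral_mul (measurable_mengerIntegrand p hγ).ennreal_ofReal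
    (measurable_share p).ennreal_ofReal (fun x => by rw [rotate, mengerIntegrand_rotate])
    fun x => ?_
  by_cases hx : circRep (x.1 - x.2.1) = 0
  · simp [mengerIntegrand_eq_zero p hper hx]
  · rw [← ENNReal.ofReal_add (share_nonneg _ _) (share_nonneg _ _),
      ← ENNReal.ofReal_add (add_nonneg (share_nonneg _ _) (share_nonneg _ _)) (share_nonneg _ _),
      share_add_share_add_share p hx, ENNReal.ofReal_one, mul_one]

theorem menger_eq_lintegral (hp : p ≠ 2) (hγ : ContDiff ℝ 1 γ) (hper : Function.Periodic γ 1) :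
    menger p 2 γ = ∫⁻ x, ENNReal.ofReal (mengerForm p (jet γ x) (defect γ x) (defect γ x))
      ∂mengerMeasure p := by
  have hdper := periodic_deriv hper
  have hΨ : Measurable fun x =>
      ENNReal.ofReal (mengerIntegrand p γ x) * ENNReal.ofReal (share p x) :=
    (measurable_mengerIntegrand p hγ).ennreal_ofReal.mul (measurable_share p).ennreal_ofReal
  rw [menger_eq_lintegral_share hγ hper, lintegral_prod_Ioc_eq_baseMeasure hΨ,
    mengerMeasure, lintegral_withDensity_eq_lintegral_mul_non_measurable _
      (measurable_mengerDensity p).ennreal_ofReal (.of_forall fun x => ENNReal.ofReal_lt_top),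
    ← lintegral_const_mul' _ _ ENNReal.ofNat_ne_top]
  · refine lintegral_congr fun x => ?_
    rw [mengerIntegrand_eq hp hγ hper, share_add_left, Pi.mul_apply,
      ← ENNReal.ofReal_mul' (share_nonneg _ _), ← ENNReal.ofReal_ofNat 3,
      ← ENNReal.ofReal_mul zero_le_three, ← ENNReal.ofReal_mul (mengerDensity_nonneg p x),
      mengerDensity]
    ring_nf
  · intro x z y
    simp only [mengerIntegrand, hdper y, hper y, periodic_share_snd p x z y]
  · intro x y z
    simp only [mengerIntegrand, hdper z, hper z, periodic_share_thd p x y z]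

end Representation

section Kernel

variable {p : ℝ}

/-- A symmetric, homogeneous majorant of `mengerDensity`. -/
noncomputable def majorant (p v w : ℝ) : ℝ :=
  |v| ^ (2 - p) * |w| ^ (2 - p) / (|v| ^ p + |w| ^ p)

theorem majorant_comm (p v w : ℝ) : majorant p v w = majorant p w v := by
  rw [majorant, majorant, add_comm, mul_comm (|v| ^ (2 - p))]

theorem majorant_nonneg (p v w : ℝ) : 0 ≤ majorant p v w := by unfold majorant; positivity

theorem measurable_majorant (p : ℝ) : Measurable fun x : ℝ × ℝ => majorant p x.1 x.2 := by
  unfold majorant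
  fun_prop

theorem abs_circRep_eq_abs {v : ℝ} (hv : |v| ≤ 1 / 2) : |circRep v| = |v| := by
  rw [abs_circRep]
  exact (AddCircle.norm_coe_eq_abs_iff 1 one_ne_zero).2 (by simpa using hv)

theorem mengerDensity_le (hp : p ≠ 2) (u : ℝ) {v w : ℝ} (hv : |v| ≤ 1 / 2) (hw : |w| ≤ 1 / 2) :
    mengerDensity p (u, v, w) ≤ 3 * majorant p v w := by
  rcases eq_or_ne v 0 with rfl | hv0
  · simp [mengerDensity, kern, majorant, Real.zero_rpow (sub_ne_zero.2 hp.symm)]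
  have hvp : 0 < |v| ^ p := Real.rpow_pos_of_pos (abs_pos.2 hv0) p
  simp only [mengerDensity, kern, share, majorant, sub_zero, zero_sub, abs_circRep_eq_abs hw,
    abs_circRep_eq_abs ((abs_neg v).trans_le hv), abs_neg]
  rw [mul_assoc _ (|circRep (v - w)| ^ (-p)), div_eq_mul_inv (|v| ^ (2 - p) * _)]
  gcongr
  calc |circRep (v - w)| ^ (-p) *
        (|circRep (v - w)| ^ p / (|circRep (v - w)| ^ p + |w| ^ p + |v| ^ p))
      = (|circRep (v - w)| ^ p)⁻¹ * |circRep (v - w)| ^ p *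
          (|circRep (v - w)| ^ p + |w| ^ p + |v| ^ p)⁻¹ := by
        rw [Real.rpow_neg (abs_nonneg _), mul_assoc, div_eq_mul_inv]
    _ ≤ 1 * (|v| ^ p + |w| ^ p)⁻¹ := by
        refine mul_le_mul inv_mul_le_one (inv_anti₀ (by positivity) ?_) (by positivity) zero_le_one
        linarith [Real.rpow_nonneg (abs_nonneg (circRep (v - w))) p]
    _ = (|v| ^ p + |w| ^ p)⁻¹ := one_mul _

theorem integrable_majorant_one (hp : 3 / 2 < p) (hp' : p < 3) : Integrable (majorant p 1) := by
  have hradial := integrable_fun_norm_addHaar (volume : Measure ℝ)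
    (f := fun t : ℝ => t ^ (2 - p) / (1 + t ^ p))
  simp only [Module.finrank_self, Real.norm_eq_abs, tsub_self, pow_zero, one_smul] at hradial
  have hmeas : Measurable fun t : ℝ => t ^ (2 - p) / (1 + t ^ p) := by fun_prop
  have hsplit : IntegrableOn (fun t : ℝ => t ^ (2 - p) / (1 + t ^ p)) (Ioc 0 1 ∪ Ioi 1) := by
    refine IntegrableOn.union ?_ ?_
    · have hint : IntegrableOn (fun t : ℝ => t ^ (2 - p)) (Ioc 0 1) :=
        (intervalIntegrable_iff_integrableOn_Ioc_of_le zero_le_one).1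
          (intervalIntegral.intervalIntegrable_rpow' (by linarith))
      refine hint.mono' hmeas.aestronglyMeasurable ?_
      filter_upwards [ae_restrict_mem measurableSet_Ioc] with t ht
      have ht0 : 0 ≤ t := ht.1.le
      rw [Real.norm_of_nonneg (by positivity)]
      exact div_le_self (by positivity) (le_add_of_nonneg_right (by positivity))
    · have hint : IntegrableOn (fun t : ℝ => t ^ (2 - 2 * p)) (Ioi 1) :=
        integrableOn_Ioi_rpow_of_lt (by linarith) one_pos
      refine hint.mono' hmeas.aestronglyMeasurable ?_
      filter_upwards [ae_restrict_mem measurableSet_Ioi] with t ht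
      have ht0 : 0 < t := one_pos.trans ht
      rw [Real.norm_of_nonneg (by positivity), show 2 - 2 * p = 2 - p - p by ring,
        Real.rpow_sub ht0 (2 - p)]
      gcongr
      linarith
  rw [Ioc_union_Ioi_eq_Ioi zero_le_one] at hsplit
  simpa [funext fun t => majorant.eq_def p 1 t] using hradial.2 hsplit

theorem lintegral_comp_mul_left {θ : ℝ} (hθ : 0 < θ) {G : ℝ → ℝ≥0∞} (hG : Measurable G) :
    ∫⁻ v, G (θ * v) = ENNReal.ofReal θ⁻¹ * ∫⁻ v, G v := by
  rw [← lintegral_map hG (measurable_const_mul θ), Real.map_volume_mul_left hθ.ne',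
    lintegral_smul_measure, abs_of_pos (inv_pos.2 hθ), smul_eq_mul]

theorem majorant_eq_mul_majorant_one {v : ℝ} (hv : v ≠ 0) (w : ℝ) :
    majorant p v w = |v| ^ (4 - 3 * p) * majorant p 1 (|v|⁻¹ * w) := by
  have hr : 0 < |v| := abs_pos.2 hv
  have hw : |w| = |v| * |(|v|⁻¹ * w)| := by
    rw [abs_mul, abs_inv, abs_abs, mul_inv_cancel_left₀ hr.ne']
  have hpow : |v| ^ (4 - 3 * p) = |v| ^ (2 - p) * |v| ^ (2 - p) / |v| ^ p := by
    rw [← Real.rpow_add hr, ← Real.rpow_sub hr]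
    ring_nf
  rw [majorant, majorant, hw, Real.mul_rpow hr.le (abs_nonneg _),
    Real.mul_rpow hr.le (abs_nonneg _), hpow, abs_one, Real.one_rpow, Real.one_rpow, one_mul,
    div_mul_div_comm, mul_one_add]
  ring

/-- The integral of `majorant p 1`, which controls the integrals of `majorant p v`. -/
noncomputable def majorantConst (p : ℝ) : ℝ := ∫ t, majorant p 1 t

theorem lintegral_majorant_le (hp : 2 < p) (hp' : p < 3) (v : ℝ) :
    ∫⁻ w, ENNReal.ofReal (majorant p v w) ≤
      ENNReal.ofReal (majorantConst p) * ENNReal.ofReal (|v| ^ (-(1 + 2 * (3 / 2 * p - 3)))) := by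
  rcases eq_or_ne v 0 with rfl | hv
  · simp [majorant, Real.zero_rpow (show 2 - p ≠ 0 by linarith)]
  have hr : 0 < |v| := abs_pos.2 hv
  have hone : Measurable fun t => ENNReal.ofReal (majorant p 1 t) :=
    ((measurable_majorant p).comp measurable_prodMk_left).ennreal_ofReal
  simp_rw [majorant_eq_mul_majorant_one hv, ENNReal.ofReal_mul (Real.rpow_nonneg hr.le _)]
  rw [lintegral_const_mul' _ _ ENNReal.ofReal_ne_top, lintegral_comp_mul_left (inv_pos.2 hr) hone,
    inv_inv, majorantConst, ofReal_integral_eq_lintegral_ofReal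
      (integrable_majorant_one (by linarith) hp') (.of_forall (majorant_nonneg p 1)),
    ← mul_assoc, ← ENNReal.ofReal_mul (by positivity), mul_comm, ← Real.rpow_add_one hr.ne',
    show 4 - 3 * p + 1 = -(1 + 2 * (3 / 2 * p - 3)) by ring]

theorem lintegral_lintegral_symm_mul_add {α : Type*} [MeasurableSpace α] {μ : Measure α}
    [SFinite μ] {k : α → α → ℝ≥0∞} (hk : Measurable (Function.uncurry k))
    (hsymm : ∀ v w, k v w = k w v) {A : α → ℝ≥0∞} (hA : Measurable A) :
    ∫⁻ v, ∫⁻ w, k v w * (A v + A w) ∂μ ∂μ = 2 * ∫⁻ v, (∫⁻ w, k v w ∂μ) * A v ∂μ := by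
  have hk₁ (v : α) : Measurable (k v) := hk.of_uncurry_left
  have hkA : Measurable fun x : α × α => k x.1 x.2 * A x.2 := hk.mul (hA.comp measurable_snd)
  have hadd (v : α) : ∫⁻ w, k v w * (A v + A w) ∂μ =
      (∫⁻ w, k v w ∂μ) * A v + ∫⁻ w, k v w * A w ∂μ := by
    simp_rw [mul_add]
    rw [lintegral_add_left ((hk₁ v).mul_const _), lintegral_mul_const _ (hk₁ v)]
  have hswap : ∫⁻ v, ∫⁻ w, k v w * A w ∂μ ∂μ = ∫⁻ v, (∫⁻ w, k v w ∂μ) * A v ∂μ := by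
    rw [lintegral_lintegral_swap hkA.aemeasurable]
    exact lintegral_congr fun v => by simp_rw [hsymm _ v, lintegral_mul_const _ (hk₁ v)]
  simp_rw [hadd]
  rw [lintegral_add_right _ hkA.lintegral_prod_right', hswap, two_mul]

theorem lintegral_lintegral_majorant_mul_add_le (hp : 2 < p) (hp' : p < 3) {μ : Measure ℝ}
    [SFinite μ] (hμ : μ ≤ volume) {A : ℝ → ℝ≥0∞} (hA : Measurable A) :
    ∫⁻ v, ∫⁻ w, ENNReal.ofReal (majorant p v w) * (A v + A w) ∂μ ∂μ ≤
      2 * (ENNReal.ofReal (majorantConst p) *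
        ∫⁻ v, ENNReal.ofReal (|v| ^ (-(1 + 2 * (3 / 2 * p - 3)))) * A v ∂μ) := by
  rw [lintegral_lintegral_symm_mul_add (measurable_majorant p).ennreal_ofReal
    (fun v w => by rw [majorant_comm]) hA, ← lintegral_const_mul' _ _ ENNReal.ofReal_ne_top]
  gcongr 2 * ∫⁻ v, ?_ ∂μ with v
  rw [← mul_assoc]
  gcongr
  exact (lintegral_mono' hμ le_rfl).trans (lintegral_majorant_le hp hp' v)

end Kernel

section Energy

variable {E : Type*} [NormedAddCommGroup E] {s p : ℝ}

theorem lintegral_centralMeasure_eq_slobodeckij_sq (s : ℝ) (g : ℝ → E) :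
    ∫⁻ u in Ioc (0 : ℝ) 1, ∫⁻ v, ENNReal.ofReal (|v| ^ (-(1 + 2 * s))) *
      ‖g (u + v) - g u‖ₑ ^ 2 ∂centralMeasure = slobodeckij s g ^ 2 := by
  rw [slobodeckij_sq]
  refine lintegral_congr fun u => ?_
  rw [centralMeasure, ← restrict_Ioo_eq_restrict_Ioc]
  refine lintegral_congr fun v => ?_
  rw [← ofReal_norm, ← ENNReal.ofReal_pow (norm_nonneg _), ← ENNReal.ofReal_mul (by positivity),
    Real.rpow_neg (abs_nonneg _), div_eq_inv_mul]

theorem enorm_sub_sq_le (a b c : E) : ‖b - a‖ₑ ^ 2 ≤ 2 * (‖a - c‖ₑ ^ 2 + ‖b - c‖ₑ ^ 2) := by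
  have htri : ‖b - a‖ₑ ≤ ‖a - c‖ₑ + ‖b - c‖ₑ := by
    simpa [enorm_sub_rev c a, add_comm] using enorm_add_le (b - c) (c - a)
  calc ‖b - a‖ₑ ^ 2 ≤ (‖a - c‖ₑ + ‖b - c‖ₑ) ^ 2 := by gcongr
    _ ≤ 2 * (‖a - c‖ₑ ^ 2 + ‖b - c‖ₑ ^ 2) := by
      have := ENNReal.rpow_add_le_mul_rpow_add_rpow ‖a - c‖ₑ ‖b - c‖ₑ one_le_two
      norm_num at this
      exact this

theorem mul_mem_Ioc_neg {θ a v : ℝ} (hθ : θ ∈ Ioc (0 : ℝ) 1) (hv : v ∈ Ioc (-a) a) :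
    θ * v ∈ Ioc (-a) a := by
  obtain ⟨hθ0, hθ1⟩ := hθ
  constructor <;> rcases le_total 0 v with h | h <;> nlinarith [hv.1, hv.2]

theorem lintegral_rpow_mul_comp_mul_left_le (hs : 0 ≤ s) {H : ℝ → ℝ≥0∞} (hH : Measurable H)
    {θ : ℝ} (hθ : θ ∈ Ioc (0 : ℝ) 1) :
    ∫⁻ v, ENNReal.ofReal (|v| ^ (-(1 + 2 * s))) * H (θ * v) ∂centralMeasure ≤
      ∫⁻ v, ENNReal.ofReal (|v| ^ (-(1 + 2 * s))) * H v ∂centralMeasure := by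
  let G : ℝ → ℝ≥0∞ := (Ioc (-(1 / 2)) (1 / 2)).indicator fun v =>
    ENNReal.ofReal (|v| ^ (-(1 + 2 * s))) * H v
  have hG : Measurable G := by
    refine Measurable.indicator ?_ measurableSet_Ioc
    fun_prop
  have hθ0 : 0 < θ := hθ.1
  have hscale (v : ℝ) : |v| ^ (-(1 + 2 * s)) = θ ^ (1 + 2 * s) * |θ * v| ^ (-(1 + 2 * s)) := by
    rw [abs_mul, abs_of_pos hθ0, Real.mul_rpow hθ0.le (abs_nonneg _), ← mul_assoc,
      ← Real.rpow_add hθ0, add_neg_cancel, Real.rpow_zero, one_mul]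
  have hfactor : θ ^ (1 + 2 * s) * θ⁻¹ ≤ 1 := by
    rw [Real.rpow_add hθ0, Real.rpow_one, mul_right_comm, mul_inv_cancel₀ hθ0.ne', one_mul]
    exact Real.rpow_le_one hθ0.le hθ.2 (by linarith)
  calc ∫⁻ v, ENNReal.ofReal (|v| ^ (-(1 + 2 * s))) * H (θ * v) ∂centralMeasure
      ≤ ∫⁻ v, ENNReal.ofReal (θ ^ (1 + 2 * s)) * G (θ * v) ∂centralMeasure := by
        refine setLIntegral_mono' measurableSet_Ioc fun v hv => ?_
        have hGθ : G (θ * v) = ENNReal.ofReal (|θ * v| ^ (-(1 + 2 * s))) * H (θ * v) :=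
          indicator_of_mem (mul_mem_Ioc_neg hθ hv) _
        rw [hGθ, hscale, ENNReal.ofReal_mul (by positivity), mul_assoc]
    _ ≤ ∫⁻ v, ENNReal.ofReal (θ ^ (1 + 2 * s)) * G (θ * v) :=
        lintegral_mono' Measure.restrict_le_self le_rfl
    _ = ENNReal.ofReal (θ ^ (1 + 2 * s) * θ⁻¹) * ∫⁻ v, G v := by
        rw [lintegral_const_mul' _ _ ENNReal.ofReal_ne_top, lintegral_comp_mul_left hθ0 hG,
          ← mul_assoc, ← ENNReal.ofReal_mul (by positivity)]
    _ ≤ ∫⁻ v, G v := mul_le_of_le_one_left' (ENNReal.ofReal_le_one.2 hfactor)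
    _ = ∫⁻ v, ENNReal.ofReal (|v| ^ (-(1 + 2 * s))) * H v ∂centralMeasure :=
        lintegral_indicator measurableSet_Ioc _

variable [NormedSpace ℝ E] {f : ℝ → E}

theorem enorm_avg_sub_deriv_sq_le [CompleteSpace E] (hf : ContDiff ℝ 1 f) (u v : ℝ) :
    ‖avg f u v - deriv f u‖ₑ ^ 2 ≤
      ∫⁻ θ in Ioc (0 : ℝ) 1, ‖deriv f (u + θ * v) - deriv f u‖ₑ ^ 2 := by
  have hc := continuous_deriv_comp_segment hf u v
  have havg : avg f u v - deriv f u =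
      ∫ θ in Ioc (0 : ℝ) 1, (deriv f (u + θ * v) - deriv f u) := by
    rw [← intervalIntegral.integral_of_le zero_le_one, intervalIntegral.integral_sub
      (hc.intervalIntegrable _ _) intervalIntegrable_const]
    simp [avg]
  calc ‖avg f u v - deriv f u‖ₑ ^ 2
      ≤ (∫⁻ θ in Ioc (0 : ℝ) 1, ‖deriv f (u + θ * v) - deriv f u‖ₑ) ^ 2 := by
        rw [havg]
        gcongr
        exact enorm_integral_le_lintegral_enorm _
    _ ≤ volume.restrict (Ioc (0 : ℝ) 1) univ *
          ∫⁻ θ in Ioc (0 : ℝ) 1, ‖deriv f (u + θ * v) - deriv f u‖ₑ ^ 2 :=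
        sq_lintegral_le (hc.sub continuous_const).enorm.measurable.aemeasurable
    _ = _ := by simp

theorem lintegral_avg_sub_deriv_le [CompleteSpace E] (hs : 0 ≤ s) (hf : ContDiff ℝ 1 f)
    (u : ℝ) :
    ∫⁻ v, ENNReal.ofReal (|v| ^ (-(1 + 2 * s))) * ‖avg f u v - deriv f u‖ₑ ^ 2
        ∂centralMeasure ≤
      ∫⁻ v, ENNReal.ofReal (|v| ^ (-(1 + 2 * s))) * ‖deriv f (u + v) - deriv f u‖ₑ ^ 2
        ∂centralMeasure := by
  have hd := hf.continuous_deriv le_rfl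
  have hH : Measurable fun v => ‖deriv f (u + v) - deriv f u‖ₑ ^ 2 := by
    have hc : Continuous fun v => deriv f (u + v) - deriv f u := by fun_prop
    exact hc.enorm.measurable.pow_const 2
  have hH' : Measurable fun x : ℝ × ℝ => ENNReal.ofReal (|x.1| ^ (-(1 + 2 * s))) *
      ‖deriv f (u + x.2 * x.1) - deriv f u‖ₑ ^ 2 := by
    have hc : Continuous fun x : ℝ × ℝ => deriv f (u + x.2 * x.1) - deriv f u := by fun_prop
    exact (measurable_fst.abs.pow_const _).ennreal_ofReal.mul (hc.enorm.measurable.pow_const 2)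
  set I := ∫⁻ v, ENNReal.ofReal (|v| ^ (-(1 + 2 * s))) * ‖deriv f (u + v) - deriv f u‖ₑ ^ 2
    ∂centralMeasure
  calc ∫⁻ v, ENNReal.ofReal (|v| ^ (-(1 + 2 * s))) * ‖avg f u v - deriv f u‖ₑ ^ 2
        ∂centralMeasure
      ≤ ∫⁻ v, (∫⁻ θ in Ioc (0 : ℝ) 1, ENNReal.ofReal (|v| ^ (-(1 + 2 * s))) *
          ‖deriv f (u + θ * v) - deriv f u‖ₑ ^ 2) ∂centralMeasure := by
        gcongr with v
        rw [lintegral_const_mul' _ _ ENNReal.ofReal_ne_top]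
        gcongr
        exact enorm_avg_sub_deriv_sq_le hf u v
    _ = ∫⁻ θ in Ioc (0 : ℝ) 1, ∫⁻ v, ENNReal.ofReal (|v| ^ (-(1 + 2 * s))) *
          ‖deriv f (u + θ * v) - deriv f u‖ₑ ^ 2 ∂centralMeasure :=
        lintegral_lintegral_swap hH'.aemeasurable
    _ ≤ ∫⁻ _ in Ioc (0 : ℝ) 1, I :=
        setLIntegral_mono' measurableSet_Ioc fun θ hθ =>
          lintegral_rpow_mul_comp_mul_left_le hs hH hθ
    _ = I := by simp

/-- The constant in the bound of the `L²` norm of the defect by the seminorm of the derivative. -/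
noncomputable def defectConst (p : ℝ) : ℝ := 12 * majorantConst p

theorem defectConst_nonneg (p : ℝ) : 0 ≤ defectConst p :=
  mul_nonneg (by norm_num) (integral_nonneg (majorant_nonneg p 1))

theorem mengerDensity_mul_defect_sq_le (hp : p ≠ 2) (u : ℝ) {v w : ℝ}
    (hv : v ∈ Ioc (-(1 / 2) : ℝ) (1 / 2)) (hw : w ∈ Ioc (-(1 / 2) : ℝ) (1 / 2)) :
    ENNReal.ofReal (mengerDensity p (u, v, w)) * ‖defect f (u, v, w)‖ₑ ^ 2 ≤
      6 * (ENNReal.ofReal (majorant p v w) *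
        (‖avg f u v - deriv f u‖ₑ ^ 2 + ‖avg f u w - deriv f u‖ₑ ^ 2)) := by
  have hdensity : ENNReal.ofReal (mengerDensity p (u, v, w)) ≤
      3 * ENNReal.ofReal (majorant p v w) := by
    rw [← ENNReal.ofReal_ofNat 3, ← ENNReal.ofReal_mul zero_le_three]
    exact ENNReal.ofReal_le_ofReal
      (mengerDensity_le hp u (abs_le.2 ⟨hv.1.le, hv.2⟩) (abs_le.2 ⟨hw.1.le, hw.2⟩))
  refine (mul_le_mul' hdensity (enorm_sub_sq_le _ _ (deriv f u))).trans_eq ?_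
  ring

theorem lintegral_defect_sq_le [CompleteSpace E] (hp : 2 < p) (hp' : p < 3)
    (hf : ContDiff ℝ 1 f) :
    ∫⁻ x, ‖defect f x‖ₑ ^ 2 ∂mengerMeasure p ≤
      ENNReal.ofReal (defectConst p) * slobodeckij (3 / 2 * p - 3) (deriv f) ^ 2 := by
  have hdefect : Measurable fun x => ‖defect f x‖ₑ ^ 2 :=
    (continuous_defect hf).enorm.measurable.pow_const 2
  have hΦ : Measurable fun x => ENNReal.ofReal (mengerDensity p x) * ‖defect f x‖ₑ ^ 2 :=
    (measurable_mengerDensity p).ennreal_ofReal.mul hdefect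
  have havg (u : ℝ) : Measurable fun v => ‖avg f u v - deriv f u‖ₑ ^ 2 :=
    ((((continuous_avg hf).comp (Continuous.prodMk_right u)).sub
      continuous_const).enorm.measurable).pow_const 2
  rw [mengerMeasure, lintegral_withDensity_eq_lintegral_mul _
    (measurable_mengerDensity p).ennreal_ofReal hdefect,
    ← lintegral_centralMeasure_eq_slobodeckij_sq,
    ← lintegral_const_mul' _ _ ENNReal.ofReal_ne_top]
  simp only [Pi.mul_apply, baseMeasure]
  rw [lintegral_prod _ hΦ.aemeasurable]
  gcongr with u
  calc ∫⁻ x, ENNReal.ofReal (mengerDensity p (u, x)) * ‖defect f (u, x)‖ₑ ^ 2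
        ∂centralMeasure.prod centralMeasure
      = ∫⁻ v, ∫⁻ w, ENNReal.ofReal (mengerDensity p (u, v, w)) * ‖defect f (u, v, w)‖ₑ ^ 2
          ∂centralMeasure ∂centralMeasure :=
        lintegral_prod _ (hΦ.comp measurable_prodMk_left).aemeasurable
    _ ≤ ∫⁻ v, ∫⁻ w, 6 * (ENNReal.ofReal (majorant p v w) *
          (‖avg f u v - deriv f u‖ₑ ^ 2 + ‖avg f u w - deriv f u‖ₑ ^ 2))
          ∂centralMeasure ∂centralMeasure :=
        setLIntegral_mono' measurableSet_Ioc fun v hv => setLIntegral_mono' measurableSet_Ioc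
          fun w hw => mengerDensity_mul_defect_sq_le hp.ne' u hv hw
    _ = 6 * ∫⁻ v, ∫⁻ w, ENNReal.ofReal (majorant p v w) *
          (‖avg f u v - deriv f u‖ₑ ^ 2 + ‖avg f u w - deriv f u‖ₑ ^ 2)
          ∂centralMeasure ∂centralMeasure := by
        simp_rw [lintegral_const_mul' _ _ (ENNReal.ofNat_ne_top (n := 6))]
    _ ≤ 6 * (2 * (ENNReal.ofReal (majorantConst p) *
          ∫⁻ v, ENNReal.ofReal (|v| ^ (-(1 + 2 * (3 / 2 * p - 3)))) *
            ‖avg f u v - deriv f u‖ₑ ^ 2 ∂centralMeasure)) := by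
        gcongr
        exact lintegral_lintegral_majorant_mul_add_le hp hp' Measure.restrict_le_self (havg u)
    _ = ENNReal.ofReal (defectConst p) *
          ∫⁻ v, ENNReal.ofReal (|v| ^ (-(1 + 2 * (3 / 2 * p - 3)))) *
            ‖avg f u v - deriv f u‖ₑ ^ 2 ∂centralMeasure := by
        rw [defectConst, ENNReal.ofReal_mul (by norm_num), ENNReal.ofReal_ofNat]
        ring
    _ ≤ _ := mul_le_mul' le_rfl (lintegral_avg_sub_deriv_le (by linarith) hf u)

theorem memLp_defect [CompleteSpace E] (hp : 2 < p) (hp' : p < 3) (hf : ContDiff ℝ 1 f)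
    (hfin : slobodeckij (3 / 2 * p - 3) (deriv f) ≠ ⊤) :
    MemLp (defect f) 2 (mengerMeasure p) := by
  refine ⟨(continuous_defect hf).aestronglyMeasurable, ?_⟩
  rw [eLpNorm_lt_top_iff_lintegral_rpow_enorm_lt_top two_ne_zero ENNReal.ofNat_ne_top]
  simp only [ENNReal.toReal_ofNat, ENNReal.rpow_ofNat]
  exact (lintegral_defect_sq_le hp hp' hf).trans_lt
    (ENNReal.mul_lt_top ENNReal.ofReal_lt_top (ENNReal.pow_lt_top hfin.lt_top))

theorem integral_defect_sq_le [CompleteSpace E] (hp : 2 < p) (hp' : p < 3)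
    (hf : ContDiff ℝ 1 f) (hfin : slobodeckij (3 / 2 * p - 3) (deriv f) ≠ ⊤) :
    ∫ x, ‖defect f x‖ ^ 2 ∂mengerMeasure p ≤
      defectConst p * slobodeckijReal (3 / 2 * p - 3) (deriv f) ^ 2 := by
  rw [integral_eq_lintegral_of_nonneg_ae (ae_of_all _ fun x => sq_nonneg _)
    ((continuous_defect hf).norm.pow 2).aestronglyMeasurable]
  refine ENNReal.toReal_le_of_le_ofReal
    (mul_nonneg (defectConst_nonneg p) (sq_nonneg _)) ?_
  rw [ENNReal.ofReal_mul (defectConst_nonneg p), slobodeckijReal,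
    ENNReal.ofReal_pow ENNReal.toReal_nonneg, ENNReal.ofReal_toReal hfin]
  simpa only [ENNReal.ofReal_pow (norm_nonneg _), ofReal_norm] using
    lintegral_defect_sq_le hp hp' hf

end Energy

section BiLipschitz

variable {E : Type*} [NormedAddCommGroup E] {γ : ℝ → E}

theorem periodic_apply_fract {α : Type*} {f : ℝ → α} (hf : Function.Periodic f 1) (u : ℝ) :
    f (Int.fract u) = f u := by
  simpa only [zsmul_one, Int.self_sub_floor] using hf.sub_zsmul_eq (x := u) ⌊u⌋

theorem norm_coe_sub_pos {u₁ u₂ : ℝ} (h : (u₁ : UnitAddCircle) ≠ u₂) :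
    0 < ‖((u₁ - u₂ : ℝ) : UnitAddCircle)‖ := by
  rw [AddCircle.coe_sub]
  exact norm_sub_pos_iff.2 h

theorem biLip_mul_le (γ : ℝ → E) (u₁ u₂ : ℝ) :
    biLip γ * ‖((u₁ - u₂ : ℝ) : UnitAddCircle)‖ ≤ ‖γ u₁ - γ u₂‖ := by
  by_cases h : (u₁ : UnitAddCircle) = u₂
  · simp [h]
  · rw [← le_div_iff₀ (norm_coe_sub_pos h)]
    refine csInf_le ⟨0, ?_⟩ ⟨u₁, u₂, h, rfl⟩
    rintro r ⟨a, b, -, rfl⟩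
    positivity

theorem abs_circRep_le (t : ℝ) : |circRep t| ≤ 1 / 2 := abs_sub_round t

/-- The jets all of whose entries have norm between `b` and `M`. -/
def annulus (E : Type*) [NormedAddCommGroup E] (b M : ℝ) : Set (Fin 6 → E) :=
  {y | ∀ i, b ≤ ‖y i‖ ∧ ‖y i‖ ≤ M}

theorem isCompact_annulus [ProperSpace E] (b M : ℝ) : IsCompact (annulus E b M) := by
  have hpi : annulus E b M = univ.pi fun _ => Metric.closedBall (0 : E) M ∩ {x | b ≤ ‖x‖} := by
    ext y
    simp [annulus, and_comm]
  rw [hpi]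
  exact isCompact_univ_pi fun _ => (isCompact_closedBall _ _).inter_right
    (isClosed_le continuous_const continuous_norm)

theorem annulus_mono {b b' M M' : ℝ} (hb : b' ≤ b) (hM : M ≤ M') :
    annulus E b M ⊆ annulus E b' M' := fun _ hy i =>
  ⟨hb.trans (hy i).1, (hy i).2.trans hM⟩

variable [NormedSpace ℝ E]

theorem periodic_avg (hper : Function.Periodic γ 1) (v : ℝ) :
    Function.Periodic (fun u => avg γ u v) 1 := fun u => by
  simp only [avg, add_right_comm u 1, periodic_deriv hper _]

variable [CompleteSpace E]

theorem le_biLip {m : ℝ} (hγ : ContDiff ℝ 1 γ) (hper : Function.Periodic γ 1)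
    (hm : ∀ u ∈ Icc (0 : ℝ) 1, ∀ v ∈ Icc (-(1 / 2) : ℝ) (1 / 2), m ≤ ‖avg γ u v‖) :
    m ≤ biLip γ := by
  refine le_csInf ?_ ?_
  · refine ⟨_, 1 / 2, 0, fun h => ?_, rfl⟩
    have hnorm : ‖((1 / 2 : ℝ) : UnitAddCircle)‖ = |(1 / 2 : ℝ)| :=
      (AddCircle.norm_coe_eq_abs_iff 1 one_ne_zero).2 (by norm_num)
    norm_num [h] at hnorm
  · rintro r ⟨u₁, u₂, hu, rfl⟩
    have hsub : circRep (u₁ - u₂) • avg γ u₂ (circRep (u₁ - u₂)) = γ u₁ - γ u₂ := by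
      rw [smul_avg hγ]
      simpa using congrArg (· - γ u₂) (periodic_apply_add_circRep hper 0 u₁ u₂)
    rw [le_div_iff₀ (norm_coe_sub_pos hu), ← abs_circRep, ← hsub, norm_smul, Real.norm_eq_abs,
      mul_comm]
    gcongr
    rw [← periodic_apply_fract (periodic_avg hper (circRep (u₁ - u₂))) u₂]
    exact hm _ ⟨Int.fract_nonneg _, (Int.fract_lt_one _).le⟩ _ (abs_le.1 (abs_circRep_le _))

theorem biLip_le_norm_avg (hγ : ContDiff ℝ 1 γ) (u : ℝ) {v : ℝ} (hv0 : v ≠ 0)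
    (hv : |v| ≤ 1 / 2) : biLip γ ≤ ‖avg γ u v‖ := by
  have h := biLip_mul_le γ (u + v) u
  rw [add_sub_cancel_left, (AddCircle.norm_coe_eq_abs_iff 1 one_ne_zero).2 (by simpa using hv),
    ← smul_avg hγ, norm_smul, Real.norm_eq_abs, mul_comm] at h
  exact le_of_mul_le_mul_left h (abs_pos.2 hv0)

theorem biLip_le_norm_deriv (hγ : ContDiff ℝ 1 γ) (u : ℝ) : biLip γ ≤ ‖deriv γ u‖ := by
  have hc : Continuous fun v => ‖avg γ u v‖ :=
    ((continuous_avg hγ).comp (Continuous.prodMk_right u)).norm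
  have hlim : Tendsto (fun v => ‖avg γ u v‖) (𝓝[≠] 0) (𝓝 ‖deriv γ u‖) := by
    simpa only [avg_zero] using (hc.tendsto 0).mono_left nhdsWithin_le_nhds
  have hsmall : ∀ᶠ v : ℝ in 𝓝[≠] 0, v ∈ Metric.closedBall (0 : ℝ) (1 / 2) :=
    mem_nhdsWithin_of_mem_nhds (Metric.closedBall_mem_nhds _ (by norm_num))
  refine ge_of_tendsto hlim ?_
  filter_upwards [hsmall, self_mem_nhdsWithin] with v hv hv0
  exact biLip_le_norm_avg hγ u hv0 (by simpa using hv)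

theorem avg_ne_zero (hγ : ContDiff ℝ 1 γ) (hper : Function.Periodic γ 1)
    (hinj : InjOn γ (Ico (0 : ℝ) 1)) (hreg : ∀ u, deriv γ u ≠ 0) (u : ℝ) {v : ℝ}
    (hv : |v| ≤ 1 / 2) : avg γ u v ≠ 0 := by
  rcases eq_or_ne v 0 with rfl | hv0
  · rw [avg_zero]
    exact hreg u
  · intro havg
    have heq : γ (u + v) = γ u := by
      rw [← sub_eq_zero, ← smul_avg hγ, havg, smul_zero]
    rw [← periodic_apply_fract hper (u + v), ← periodic_apply_fract hper u] at heq
    obtain ⟨z, hz⟩ := Int.fract_eq_fract.1 <| hinj ⟨Int.fract_nonneg _, Int.fract_lt_one _⟩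
      ⟨Int.fract_nonneg _, Int.fract_lt_one _⟩ heq
    obtain rfl : v = z := by simpa using hz
    have : (1 : ℝ) ≤ |(z : ℝ)| := by exact_mod_cast Int.one_le_abs (Int.cast_ne_zero.1 hv0)
    linarith

theorem biLip_pos (hγ : ContDiff ℝ 1 γ) (hper : Function.Periodic γ 1)
    (hinj : InjOn γ (Ico (0 : ℝ) 1)) (hreg : ∀ u, deriv γ u ≠ 0) : 0 < biLip γ := by
  have hcompact : IsCompact (Icc (0 : ℝ) 1 ×ˢ Icc (-(1 / 2) : ℝ) (1 / 2)) :=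
    isCompact_Icc.prod isCompact_Icc
  obtain ⟨x, hx, hmin⟩ := hcompact.exists_isMinOn
    ⟨((0 : ℝ), (0 : ℝ)), by constructor <;> norm_num⟩ (continuous_avg hγ).norm.continuousOn
  calc 0 < ‖avg γ x.1 x.2‖ := norm_pos_iff.2 (avg_ne_zero hγ hper hinj hreg _ (abs_le.2 hx.2))
    _ ≤ biLip γ := le_biLip hγ hper fun u hu v hv => hmin (a := (u, v)) ⟨hu, hv⟩

theorem annulus_subset_regularSet {n : ℕ} {b M : ℝ} (hb : 0 < b) :
    annulus (EuclideanSpace ℝ (Fin n)) b M ⊆ regularSet n := fun _ hy i =>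
  norm_pos_iff.1 (hb.trans_le (hy i).1)

theorem ae_mengerMeasure {p : ℝ} (hp : 2 < p) :
    ∀ᵐ x ∂mengerMeasure p, (x.2.1 ≠ 0 ∧ |x.2.1| ≤ 1 / 2) ∧ (x.2.2 ≠ 0 ∧ |x.2.2| ≤ 1 / 2) ∧
      circRep (x.2.1 - x.2.2) ≠ 0 := by
  rw [mengerMeasure, ae_withDensity_iff (measurable_mengerDensity p).ennreal_ofReal]
  have hbase : ∀ᵐ x ∂baseMeasure, x ∈ Ioc (0 : ℝ) 1 ×ˢ
      (Ioc (-(1 / 2) : ℝ) (1 / 2) ×ˢ Ioc (-(1 / 2) : ℝ) (1 / 2)) := by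
    rw [baseMeasure, centralMeasure, Measure.prod_restrict, Measure.prod_restrict]
    exact ae_restrict_mem (measurableSet_Ioc.prod (measurableSet_Ioc.prod measurableSet_Ioc))
  filter_upwards [hbase] with x ⟨_, hv, hw⟩ hdensity
  have hkern : kern p x.2.1 x.2.2 ≠ 0 := fun h => hdensity (by simp [mengerDensity, h])
  have h2p : 2 - p ≠ 0 := (sub_neg.2 hp).ne
  have hp0 : -p ≠ 0 := by linarith
  exact ⟨⟨fun h => hkern (by simp [kern, h, h2p]), abs_le.2 ⟨hv.1.le, hv.2⟩⟩,
    ⟨fun h => hkern (by simp [kern, h, h2p]), abs_le.2 ⟨hw.1.le, hw.2⟩⟩,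
    fun h => hkern (by simp [kern, h, hp0])⟩

theorem jet_mem_annulus {p M : ℝ} (hp : 2 < p) (hγ : ContDiff ℝ 1 γ)
    (hM : ∀ u, ‖deriv γ u‖ ≤ M) : ∀ᵐ x ∂mengerMeasure p, jet γ x ∈ annulus E (biLip γ) M := by
  filter_upwards [ae_mengerMeasure hp] with x ⟨⟨hv0, hv⟩, ⟨hw0, hw⟩, hvw⟩ i
  refine ⟨?_, (norm_le_pi_norm _ i).trans (norm_jet_le hM x)⟩
  fin_cases i
  · exact biLip_le_norm_avg hγ _ hv0 hv
  · exact biLip_le_norm_avg hγ _ hw0 hw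
  · exact biLip_le_norm_avg hγ _ hvw (abs_circRep_le _)
  · exact biLip_le_norm_deriv hγ _
  · exact biLip_le_norm_deriv hγ _
  · exact biLip_le_norm_deriv hγ _

end BiLipschitz

section Homogeneity

variable {E : Type*} [NormedAddCommGroup E] [NormedSpace ℝ E]
  {F : (ℝ → E) → ℝ≥0∞} {f g h γ : ℝ → E} {s d d' : ℝ}

theorem HasWeakDeriv.const_smul (hfg : HasWeakDeriv f g) (c : ℝ) :
    HasWeakDeriv (c • f) (c • g) := by
  refine ⟨hfg.1.smul c, hfg.2.1.smul c, fun φ hφ hsupp => ?_⟩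
  simp only [Pi.smul_apply, smul_comm _ c, integral_smul, hfg.2.2 φ hφ hsupp, smul_neg]

theorem slobodeckij_const_smul (s c : ℝ) (f : ℝ → E) :
    slobodeckij s (c • f) = ‖c‖ₑ * slobodeckij s f := by
  have hintegrand (u w : ℝ) : ENNReal.ofReal (‖(c • f) (u + w) - (c • f) u‖ ^ 2 /
      |w| ^ (1 + 2 * s)) =
        ‖c‖ₑ ^ 2 * ENNReal.ofReal (‖f (u + w) - f u‖ ^ 2 / |w| ^ (1 + 2 * s)) := by
    rw [Pi.smul_apply, Pi.smul_apply, ← smul_sub, norm_smul, mul_pow, mul_div_assoc,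
      ENNReal.ofReal_mul (by positivity), ENNReal.ofReal_pow (norm_nonneg c), ofReal_norm]
  have hc : ‖c‖ₑ ^ 2 ≠ ⊤ := ENNReal.pow_ne_top enorm_ne_top
  simp only [slobodeckij, hintegrand, lintegral_const_mul' _ _ hc]
  rw [ENNReal.mul_rpow_of_nonneg _ _ (by norm_num), ← ENNReal.rpow_natCast_mul]
  norm_num

theorem slobodeckijReal_deriv_const_smul (s c : ℝ) (f : ℝ → E) :
    slobodeckijReal s (deriv (c • f)) = |c| * slobodeckijReal s (deriv f) := by
  rw [show deriv (c • f) = c • deriv f from funext fun u => deriv_const_smul_field c f,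
    slobodeckijReal, slobodeckij_const_smul, ENNReal.toReal_mul, toReal_enorm, Real.norm_eq_abs,
    slobodeckijReal]

theorem periodic_const_smul (hf : Function.Periodic f 1) (c : ℝ) : Function.Periodic (c • f) 1 :=
  fun u => by simp [hf u]

theorem MemW.const_smul (hf : MemW s f) (c : ℝ) : MemW s (c • f) := by
  obtain ⟨hper, hc, g, hgper, hg, hg2, hfin⟩ := hf
  refine ⟨periodic_const_smul hper c, hc.const_smul c, c • g, periodic_const_smul hgper c,
    hg.const_smul c, hg2.const_smul c, ?_⟩
  rw [slobodeckij_const_smul]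
  exact ENNReal.mul_ne_top enorm_ne_top hfin

theorem tendsto_mul_const_zero (c : ℝ) : Tendsto (fun τ : ℝ => τ * c) (𝓝 0) (𝓝 0) := by
  simpa using (continuous_mul_const c).tendsto 0

theorem hasDerivAt_comp_mul_const {φ : ℝ → ℝ} (hφ : HasDerivAt φ d 0) (c : ℝ) :
    HasDerivAt (fun τ => φ (τ * c)) (c * d) 0 := by
  rw [mul_comm]
  exact HasDerivAt.comp (h₂ := φ) (0 : ℝ) (by simpa using hφ) (hasDerivAt_mul_const c)

theorem HasFirstVariation.unique (hd : HasFirstVariation F γ h d)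
    (hd' : HasFirstVariation F γ h d') : d = d' :=
  hd.2.unique hd'.2

theorem HasFirstVariation.const_smul (hd : HasFirstVariation F γ h d) (c : ℝ) :
    HasFirstVariation F γ (c • h) (c * d) := by
  simp only [HasFirstVariation, smul_smul]
  exact ⟨(tendsto_mul_const_zero c).eventually hd.1, hasDerivAt_comp_mul_const hd.2 c⟩

theorem HasSecondVariation.unique (hd : HasSecondVariation F γ h g d)
    (hd' : HasSecondVariation F γ h g d') : d = d' := by
  obtain ⟨δF, hδF, hderiv⟩ := hd
  obtain ⟨δF', hδF', hderiv'⟩ := hd'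
  refine hderiv.unique (hderiv'.congr_of_eventuallyEq ?_)
  filter_upwards [hδF, hδF'] with τ h₁ h₂ using h₁.unique h₂

theorem HasSecondVariation.const_smul_left (hd : HasSecondVariation F γ h g d) (c : ℝ) :
    HasSecondVariation F γ (c • h) g (c * d) := by
  obtain ⟨δF, hδF, hderiv⟩ := hd
  exact ⟨fun τ => c * δF τ, hδF.mono fun τ hτ => hτ.const_smul c, hderiv.const_mul c⟩

theorem HasSecondVariation.const_smul_right (hd : HasSecondVariation F γ h g d) (c : ℝ) :
    HasSecondVariation F γ h (c • g) (c * d) := by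
  obtain ⟨δF, hδF, hderiv⟩ := hd
  refine ⟨fun τ => δF (τ * c), ?_, hasDerivAt_comp_mul_const hderiv c⟩
  simpa only [smul_smul] using (tendsto_mul_const_zero c).eventually hδF

theorem le_mul_of_forall_pos_mul_le {x c q : ℝ} (hq : 0 ≤ q)
    (h : ∀ t > 0, t * q ≤ 1 → t * x ≤ c) : x ≤ c * q := by
  rcases hq.eq_or_lt with rfl | hq
  · by_contra! hx
    rw [mul_zero] at hx
    have := h ((|c| + 1) / x) (by positivity) (by simp)
    rw [div_mul_cancel₀ _ hx.ne'] at this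
    linarith [le_abs_self c]
  · have := h q⁻¹ (by positivity) (inv_mul_cancel₀ hq.ne').le
    rwa [inv_mul_le_iff₀ hq, mul_comm] at this

theorem exists_abs_le_mul_slobodeckijReal {c : ℝ} {R : (ℝ → E) → ℝ → Prop}
    (hsmul : ∀ {f d}, R f d → ∀ t : ℝ, R (t • f) (t * d))
    (hunique : ∀ {f d d'}, R f d → R f d' → d = d')
    (hR : ∀ f, MemW s f → slobodeckijReal s (deriv f) ≤ 1 → ∃ d, R f d ∧ |d| ≤ c)
    (hf : MemW s f) : ∃ d, R f d ∧ |d| ≤ c * slobodeckijReal s (deriv f) := by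
  set q := slobodeckijReal s (deriv f)
  have hq0 : 0 ≤ q := ENNReal.toReal_nonneg
  have hscaled : ∀ t > 0, t * q ≤ 1 → ∃ d, R (t • f) d ∧ |d| ≤ c := fun t ht htq =>
    hR _ (hf.const_smul t) (by rwa [slobodeckijReal_deriv_const_smul, abs_of_pos ht])
  obtain ⟨d, hd, -⟩ := hscaled (q + 1)⁻¹ (by positivity)
    ((inv_mul_le_one₀ (by positivity)).2 (by linarith))
  have hd := hsmul hd (q + 1)
  rw [smul_inv_smul₀ (by positivity)] at hd
  refine ⟨_, hd, le_mul_of_forall_pos_mul_le hq0 fun t ht htq => ?_⟩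
  obtain ⟨d', hd', hd'c⟩ := hscaled t ht htq
  rwa [hunique hd' (hsmul hd t), abs_mul, abs_of_pos ht] at hd'c

end Homogeneity

section MonotoneConstant

variable {Z W : Type*} [TopologicalSpace Z] [NormedAddCommGroup W] {f : Z → W}

theorem norm_le_iSup_norm {K : Set Z} (hK : IsCompact K) (hf : ContinuousOn f K) {z : Z}
    (hz : z ∈ K) : ‖f z‖ ≤ ⨆ w : K, ‖f w‖ := by
  refine le_ciSup (f := fun w : K => ‖f w‖) ?_ ⟨z, hz⟩
  obtain ⟨c, hc⟩ := hK.exists_bound_of_continuousOn hf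
  exact ⟨c, by rintro _ ⟨w, rfl⟩; exact hc w w.2⟩

theorem iSup_norm_mono {K K' : Set Z} (hK' : IsCompact K') (hf : ContinuousOn f K')
    (hKK' : K ⊆ K') : ⨆ w : K, ‖f w‖ ≤ ⨆ w : K', ‖f w‖ :=
  Real.iSup_le (fun w => norm_le_iSup_norm hK' hf (hKK' w.2))
    (Real.iSup_nonneg fun _ => norm_nonneg _)

theorem isMonotoneConstant_iSup_norm_mul {K : ℝ → ℝ → Set Z} {P : ℝ → ℝ}
    (hK : ∀ b a, IsCompact (K b a)) (hf : ∀ b a, 0 < b → ContinuousOn f (K b a))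
    (hmono : ∀ ⦃b b' a a'⦄, b' ≤ b → a ≤ a' → K b a ⊆ K b' a')
    (hP : ∀ a, 0 ≤ P a) (hPmono : MonotoneOn P (Ici 0)) :
    IsMonotoneConstant fun b a => (⨆ z : K b a, ‖f z‖) * P a := by
  constructor
  · intro a _ b hb b' _ hbb'
    exact mul_le_mul_of_nonneg_right
      (iSup_norm_mono (hK b a) (hf b a hb) (hmono hbb' le_rfl)) (hP a)
  · intro b hb a ha a' ha' haa'
    exact mul_le_mul (iSup_norm_mono (hK b a') (hf b a' hb) (hmono le_rfl haa'))
      (hPmono ha ha' haa') (hP a) (Real.iSup_nonneg fun _ => norm_nonneg _)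

end MonotoneConstant

section Variation

set_option maxSynthPendingDepth 3

variable {n : ℕ} {p : ℝ} {γ h g : ℝ → EuclideanSpace ℝ (Fin n)}
  {K L M : Set (Fin 6 → EuclideanSpace ℝ (Fin n))}

theorem periodic_add_smul (hγ : Function.Periodic γ 1) (hh : Function.Periodic h 1) (τ : ℝ) :
    Function.Periodic (γ + τ • h) 1 :=
  hγ.add (periodic_const_smul hh τ)

theorem contDiff_add_smul (hγ : ContDiff ℝ 1 γ) (hh : ContDiff ℝ 1 h) (τ : ℝ) :
    ContDiff ℝ 1 (γ + τ • h) :=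
  hγ.add (hh.const_smul τ)

theorem isOpen_regularSet_prod_univ :
    IsOpen (regularSet n ×ˢ (univ : Set (Fin 6 → EuclideanSpace ℝ (Fin n)))) :=
  isOpen_regularSet.prod isOpen_univ

theorem contDiffOn_prolong_mengerForm (p : ℝ) {k : WithTop ℕ∞} :
    ContDiffOn ℝ k (prolong (mengerForm (n := n) p)) (regularSet n ×ˢ univ) :=
  contDiffOn_prolong isOpen_regularSet (contDiffOn_mengerForm p)

theorem menger_add_smul (hp : p ≠ 2) (hγ : ContDiff ℝ 1 γ) (hγper : Function.Periodic γ 1)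
    (hh : ContDiff ℝ 1 h) (hhper : Function.Periodic h 1) (τ : ℝ) :
    menger p 2 (γ + τ • h) = ∫⁻ x, ENNReal.ofReal (mengerForm p (jet γ x + τ • jet h x)
      (defect γ x + τ • defect h x) (defect γ x + τ • defect h x)) ∂mengerMeasure p := by
  rw [menger_eq_lintegral hp (contDiff_add_smul hγ hh τ) (periodic_add_smul hγper hhper τ)]
  simp only [jet_add_smul hγ hh, defect_add_smul hγ hh]

theorem hasFirstVariation_menger (hp : p ≠ 2) (hγ : ContDiff ℝ 1 γ)
    (hγper : Function.Periodic γ 1) (hh : ContDiff ℝ 1 h) (hhper : Function.Periodic h 1)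
    (hK : IsCompact K) (hKU : K ⊆ regularSet n) (hL : IsCompact L)
    (hγK : IsAdmissible (mengerMeasure p) K (jet γ) (defect γ))
    (hhL : IsAdmissible (mengerMeasure p) L (jet h) (defect h)) :
    HasFirstVariation (menger p 2) γ h (∫ x, prolong (mengerForm p) (jet γ x, jet h x)
      (defect γ x, defect h x) (defect γ x, defect h x) ∂mengerMeasure p) := by
  have hint := hγK.eventually_integrable_apply_apply hhL hK hL hKU isOpen_regularSet
    (contDiffOn_mengerForm p (k := 0)).continuousOn
  have hderiv := hγK.hasDerivAt_integral_apply_apply hhL hK hL hKU isOpen_regularSet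
    (contDiffOn_mengerForm p)
  refine ⟨?_, hderiv.congr_of_eventuallyEq ?_⟩ <;> filter_upwards [hint] with τ hτ <;>
    rw [menger_add_smul hp hγ hγper hh hhper]
  · exact hτ.lintegral_lt_top.ne
  · rw [integral_eq_lintegral_of_nonneg_ae (.of_forall fun x => mengerForm_self_nonneg _ _ _)
      hτ.aestronglyMeasurable]

theorem hasSecondVariation_menger (hp : p ≠ 2) (hγ : ContDiff ℝ 1 γ)
    (hγper : Function.Periodic γ 1) (hh : ContDiff ℝ 1 h) (hhper : Function.Periodic h 1)
    (hg : ContDiff ℝ 1 g) (hgper : Function.Periodic g 1)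
    (hK : IsCompact K) (hKU : K ⊆ regularSet n) (hL : IsCompact L) (hM : IsCompact M)
    (hγK : IsAdmissible (mengerMeasure p) K (jet γ) (defect γ))
    (hhL : IsAdmissible (mengerMeasure p) L (jet h) (defect h))
    (hgM : IsAdmissible (mengerMeasure p) M (jet g) (defect g)) :
    HasSecondVariation (menger p 2) γ h g (∫ x, prolong (prolong (mengerForm p))
      ((jet γ x, jet h x), (jet g x, 0)) ((defect γ x, defect h x), (defect g x, 0))
      ((defect γ x, defect h x), (defect g x, 0)) ∂mengerMeasure p) := by
  refine ⟨_, ?_, (hγK.prodMk hhL).hasDerivAt_integral_apply_apply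
    (hgM.prodMk (isAdmissible_zero _)) (hK.prod hL) (hM.prod isCompact_singleton)
    (prod_mono hKU (subset_univ L)) isOpen_regularSet_prod_univ
    (contDiffOn_prolong_mengerForm p)⟩
  obtain ⟨K', hK'U, hK', hmem⟩ :=
    exists_isCompact_eventually_add_smul_mem isOpen_regularSet hK hKU hM
  filter_upwards [hmem] with τ hτ
  have hγg : IsAdmissible (mengerMeasure p) K' (jet (γ + τ • g)) (defect (γ + τ • g)) := by
    rw [funext (jet_add_smul hγ hg τ), funext (defect_add_smul hγ hg τ)]
    exact hγK.add_smul hgM hτ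
  simpa only [jet_add_smul hγ hg, defect_add_smul hγ hg, Prod.smul_mk, Prod.mk_add_mk, smul_zero,
    add_zero] using hasFirstVariation_menger hp (contDiff_add_smul hγ hg τ)
      (periodic_add_smul hγper hgper τ) hh hhper hK' hK'U hL hγg hhL

end Variation

section Bound

set_option maxSynthPendingDepth 3

variable {n : ℕ} {p a b : ℝ} {γ h g : ℝ → EuclideanSpace ℝ (Fin n)}

/-- A compact set containing almost all values of `(jet γ, jet h)` for curves `γ` with bilipschitz
constant `b` and seminorm `a` and directions `h` with seminorm at most `1`. -/
def firstJets (n : ℕ) (p b a : ℝ) :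
    Set ((Fin 6 → EuclideanSpace ℝ (Fin n)) × (Fin 6 → EuclideanSpace ℝ (Fin n))) :=
  annulus _ b (morreyConst (3 / 2 * p - 3) * a) ×ˢ
    Metric.closedBall 0 (morreyConst (3 / 2 * p - 3))

/-- A compact set containing almost all values of `((jet γ, jet h), (jet g, 0))` for `γ` and `h`
as in `firstJets` and directions `g` with seminorm at most `1`. -/
def secondJets (n : ℕ) (p b a : ℝ) :
    Set (((Fin 6 → EuclideanSpace ℝ (Fin n)) × (Fin 6 → EuclideanSpace ℝ (Fin n))) ×
      ((Fin 6 → EuclideanSpace ℝ (Fin n)) × (Fin 6 → EuclideanSpace ℝ (Fin n)))) :=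
  firstJets n p b a ×ˢ Metric.closedBall 0 (morreyConst (3 / 2 * p - 3)) ×ˢ {0}

theorem isCompact_firstJets : IsCompact (firstJets n p b a) :=
  (isCompact_annulus _ _).prod (isCompact_closedBall _ _)

theorem isCompact_secondJets : IsCompact (secondJets n p b a) :=
  isCompact_firstJets.prod ((isCompact_closedBall _ _).prod isCompact_singleton)

theorem firstJets_mono (hp : 7 / 3 < p) ⦃b b' a a' : ℝ⦄ (hb : b' ≤ b) (ha : a ≤ a') :
    firstJets n p b a ⊆ firstJets n p b' a' := by
  have := morreyConst_nonneg (s := 3 / 2 * p - 3) (by linarith)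
  exact prod_mono_left (annulus_mono hb (by gcongr))

theorem secondJets_mono (hp : 7 / 3 < p) ⦃b b' a a' : ℝ⦄ (hb : b' ≤ b) (ha : a ≤ a') :
    secondJets n p b a ⊆ secondJets n p b' a' :=
  prod_mono_left (firstJets_mono hp hb ha)

theorem firstJets_subset (hb : 0 < b) : firstJets n p b a ⊆ regularSet n ×ˢ univ :=
  prod_mono (annulus_subset_regularSet hb) (subset_univ _)

theorem continuousOn_prolong_mengerForm (hb : 0 < b) :
    ContinuousOn (prolong (mengerForm (n := n) p)) (firstJets n p b a) :=
  (contDiffOn_prolong_mengerForm p (k := 0)).continuousOn.mono (firstJets_subset hb)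

theorem continuousOn_prolong_prolong_mengerForm (hb : 0 < b) :
    ContinuousOn (prolong (prolong (mengerForm (n := n) p))) (secondJets n p b a) :=
  (contDiffOn_prolong isOpen_regularSet_prod_univ
    (contDiffOn_prolong_mengerForm p) (k := 0)).continuousOn.mono
      (prod_mono (firstJets_subset hb) (subset_univ _))

/-- The bound for the first variation in directions of seminorm at most `1`: the last factor is
the bound of the squared norm of the defects from `MemW.integral_defect_prodMk_sq_le`. -/
noncomputable def firstVariationConst (n : ℕ) (p b a : ℝ) : ℝ :=
  (⨆ z : firstJets n p b a, ‖prolong (mengerForm (n := n) p) z‖) * (defectConst p * (a ^ 2 + 1))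

/-- The bound for the second variation in directions of seminorm at most `1`, in analogy with
`firstVariationConst`. -/
noncomputable def secondVariationConst (n : ℕ) (p b a : ℝ) : ℝ :=
  (⨆ z : secondJets n p b a, ‖prolong (prolong (mengerForm (n := n) p)) z‖) *
    (defectConst p * (a ^ 2 + 2))

theorem monotoneOn_mul_sq_add {c d : ℝ} (hc : 0 ≤ c) :
    MonotoneOn (fun a : ℝ => c * (a ^ 2 + d)) (Ici 0) := fun a ha a' _ haa' => by
  have : 0 ≤ a := ha
  dsimp only
  gcongr

theorem isMonotoneConstant_firstVariationConst (n : ℕ) (hp : 7 / 3 < p) :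
    IsMonotoneConstant (firstVariationConst n p) :=
  isMonotoneConstant_iSup_norm_mul (fun _ _ => isCompact_firstJets)
    (fun _ _ => continuousOn_prolong_mengerForm) (firstJets_mono hp)
    (fun a => mul_nonneg (defectConst_nonneg p) (by positivity))
    (monotoneOn_mul_sq_add (defectConst_nonneg p))

theorem isMonotoneConstant_secondVariationConst (n : ℕ) (hp : 7 / 3 < p) :
    IsMonotoneConstant (secondVariationConst n p) :=
  isMonotoneConstant_iSup_norm_mul (fun _ _ => isCompact_secondJets)
    (fun _ _ => continuousOn_prolong_prolong_mengerForm) (secondJets_mono hp)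
    (fun a => mul_nonneg (defectConst_nonneg p) (by positivity))
    (monotoneOn_mul_sq_add (defectConst_nonneg p))

theorem MemW.isAdmissible {K : Set (Fin 6 → EuclideanSpace ℝ (Fin n))} (hp : 7 / 3 < p)
    (hp' : p < 3) (hf : MemW (3 / 2 * p - 3) h) (hK : ∀ᵐ x ∂mengerMeasure p, jet h x ∈ K) :
    IsAdmissible (mengerMeasure p) K (jet h) (defect h) where
  aestronglyMeasurable := (measurable_jet (hf.contDiff (by linarith))).aestronglyMeasurable
  ae_mem := hK
  memLp := memLp_defect (by linarith) hp' (hf.contDiff (by linarith))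
    (hf.slobodeckij_deriv_ne_top (by linarith))

theorem MemW.isAdmissible_annulus (hp : 7 / 3 < p) (hp' : p < 3) (hγ : MemW (3 / 2 * p - 3) γ) :
    IsAdmissible (mengerMeasure p) (annulus _ (biLip γ)
      (morreyConst (3 / 2 * p - 3) * slobodeckijReal (3 / 2 * p - 3) (deriv γ)))
      (jet γ) (defect γ) :=
  hγ.isAdmissible hp hp' <| jet_mem_annulus (by linarith) (hγ.contDiff (by linarith))
    (hγ.norm_deriv_le (by linarith))

theorem MemW.isAdmissible_closedBall (hp : 7 / 3 < p) (hp' : p < 3)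
    (hh : MemW (3 / 2 * p - 3) h) (hh1 : slobodeckijReal (3 / 2 * p - 3) (deriv h) ≤ 1) :
    IsAdmissible (mengerMeasure p) (Metric.closedBall 0 (morreyConst (3 / 2 * p - 3)))
      (jet h) (defect h) := by
  have hs : 1 / 2 < 3 / 2 * p - 3 := by linarith
  refine hh.isAdmissible hp hp' (.of_forall fun x => mem_closedBall_zero_iff.2 ?_)
  exact norm_jet_le (fun u => (hh.norm_deriv_le hs u).trans
    (mul_le_of_le_one_right (morreyConst_nonneg hs) hh1)) x

theorem MemW.integral_defect_sq_le (hp : 7 / 3 < p) (hp' : p < 3)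
    (hh : MemW (3 / 2 * p - 3) h) (hh1 : slobodeckijReal (3 / 2 * p - 3) (deriv h) ≤ 1) :
    ∫ x, ‖defect h x‖ ^ 2 ∂mengerMeasure p ≤ defectConst p := by
  refine (Menger.integral_defect_sq_le (by linarith) hp' (hh.contDiff (by linarith))
    (hh.slobodeckij_deriv_ne_top (by linarith))).trans ?_
  exact mul_le_of_le_one_right (defectConst_nonneg p) (pow_le_one₀ ENNReal.toReal_nonneg hh1)

theorem MemW.integral_defect_prodMk_sq_le (hp : 7 / 3 < p) (hp' : p < 3)
    (hγ : MemW (3 / 2 * p - 3) γ) (hh : MemW (3 / 2 * p - 3) h)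
    (hh1 : slobodeckijReal (3 / 2 * p - 3) (deriv h) ≤ 1) :
    ∫ x, ‖(defect γ x, defect h x)‖ ^ 2 ∂mengerMeasure p ≤
      defectConst p * (slobodeckijReal (3 / 2 * p - 3) (deriv γ) ^ 2 + 1) := by
  have hγ2 := Menger.integral_defect_sq_le (by linarith) hp' (hγ.contDiff (by linarith))
    (hγ.slobodeckij_deriv_ne_top (by linarith))
  rw [mul_add, mul_one]
  exact (integral_norm_prodMk_sq_le (hγ.isAdmissible_annulus hp hp').memLp
    (hh.isAdmissible_closedBall hp hp' hh1).memLp).trans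
      (add_le_add hγ2 (hh.integral_defect_sq_le hp hp' hh1))

theorem MemWir.biLip_pos {s : ℝ} (hs : 1 / 2 < s) (hγ : MemWir s γ) : 0 < biLip γ :=
  Menger.biLip_pos (hγ.1.contDiff hs) hγ.1.1 hγ.2.1 hγ.2.2

theorem exists_hasFirstVariation_menger_of_le_one (hp : 7 / 3 < p) (hp' : p < 3)
    (hγ : MemWir (3 / 2 * p - 3) γ) (hh : MemW (3 / 2 * p - 3) h)
    (hh1 : slobodeckijReal (3 / 2 * p - 3) (deriv h) ≤ 1) :
    ∃ d, HasFirstVariation (menger p 2) γ h d ∧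
      |d| ≤ firstVariationConst n p (biLip γ) (slobodeckijReal (3 / 2 * p - 3) (deriv γ)) := by
  have hs : 1 / 2 < 3 / 2 * p - 3 := by linarith
  have hb := hγ.biLip_pos hs
  have hγK := hγ.1.isAdmissible_annulus hp hp'
  have hhL := hh.isAdmissible_closedBall hp hp' hh1
  refine ⟨_, hasFirstVariation_menger (by linarith) (hγ.1.contDiff hs) hγ.1.1 (hh.contDiff hs) hh.1
    (isCompact_annulus _ _) (annulus_subset_regularSet hb) (isCompact_closedBall _ _) hγK hhL, ?_⟩
  refine ((hγK.prodMk hhL).abs_integral_apply_apply_le fun z hz =>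
    norm_le_iSup_norm isCompact_firstJets (continuousOn_prolong_mengerForm hb) hz).trans ?_
  exact mul_le_mul_of_nonneg_left (hγ.1.integral_defect_prodMk_sq_le hp hp' hh hh1)
    (Real.iSup_nonneg fun _ => norm_nonneg _)

theorem exists_hasSecondVariation_menger_of_le_one (hp : 7 / 3 < p) (hp' : p < 3)
    (hγ : MemWir (3 / 2 * p - 3) γ) (hh : MemW (3 / 2 * p - 3) h)
    (hh1 : slobodeckijReal (3 / 2 * p - 3) (deriv h) ≤ 1) (hg : MemW (3 / 2 * p - 3) g)
    (hg1 : slobodeckijReal (3 / 2 * p - 3) (deriv g) ≤ 1) :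
    ∃ d, HasSecondVariation (menger p 2) γ h g d ∧
      |d| ≤ secondVariationConst n p (biLip γ) (slobodeckijReal (3 / 2 * p - 3) (deriv γ)) := by
  have hs : 1 / 2 < 3 / 2 * p - 3 := by linarith
  have hb := hγ.biLip_pos hs
  have hγK := hγ.1.isAdmissible_annulus hp hp'
  have hhL := hh.isAdmissible_closedBall hp hp' hh1
  have hgM := hg.isAdmissible_closedBall hp hp' hg1
  have hγh := hγK.prodMk hhL
  have hg0 := hgM.prodMk (isAdmissible_zero (Y := Fin 6 → EuclideanSpace ℝ (Fin n))
    (E := EuclideanSpace ℝ (Fin n)) (mengerMeasure p))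
  refine ⟨_, hasSecondVariation_menger (by linarith) (hγ.1.contDiff hs) hγ.1.1 (hh.contDiff hs)
    hh.1 (hg.contDiff hs) hg.1 (isCompact_annulus _ _) (annulus_subset_regularSet hb)
    (isCompact_closedBall _ _) (isCompact_closedBall _ _) hγK hhL hgM, ?_⟩
  refine ((hγh.prodMk hg0).abs_integral_apply_apply_le fun z hz => norm_le_iSup_norm
    isCompact_secondJets (continuousOn_prolong_prolong_mengerForm hb) hz).trans ?_
  refine mul_le_mul_of_nonneg_left ?_ (Real.iSup_nonneg fun _ => norm_nonneg _)
  have hg0_sq : ∫ x, ‖(defect g x, (0 : EuclideanSpace ℝ (Fin n)))‖ ^ 2 ∂mengerMeasure p ≤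
      defectConst p := by
    simpa only [Prod.norm_mk, norm_zero, sup_of_le_left (norm_nonneg _)] using
      hg.integral_defect_sq_le hp hp' hg1
  linarith [integral_norm_prodMk_sq_le hγh.memLp hg0.memLp,
    hγ.1.integral_defect_prodMk_sq_le hp hp' hh hh1]

theorem exists_hasFirstVariation_menger (hp : 7 / 3 < p) (hp' : p < 3)
    (hγ : MemWir (3 / 2 * p - 3) γ) (hh : MemW (3 / 2 * p - 3) h) :
    ∃ d, HasFirstVariation (menger p 2) γ h d ∧
      |d| ≤ firstVariationConst n p (biLip γ) (slobodeckijReal (3 / 2 * p - 3) (deriv γ)) *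
        slobodeckijReal (3 / 2 * p - 3) (deriv h) :=
  exists_abs_le_mul_slobodeckijReal HasFirstVariation.const_smul HasFirstVariation.unique
    (fun _ hh hh1 => exists_hasFirstVariation_menger_of_le_one hp hp' hγ hh hh1) hh

theorem exists_hasSecondVariation_menger (hp : 7 / 3 < p) (hp' : p < 3)
    (hγ : MemWir (3 / 2 * p - 3) γ) (hh : MemW (3 / 2 * p - 3) h)
    (hg : MemW (3 / 2 * p - 3) g) :
    ∃ d, HasSecondVariation (menger p 2) γ h g d ∧
      |d| ≤ secondVariationConst n p (biLip γ) (slobodeckijReal (3 / 2 * p - 3) (deriv γ)) *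
        slobodeckijReal (3 / 2 * p - 3) (deriv h) * slobodeckijReal (3 / 2 * p - 3) (deriv g) := by
  refine exists_abs_le_mul_slobodeckijReal (R := HasSecondVariation (menger p 2) γ h)
    HasSecondVariation.const_smul_right HasSecondVariation.unique (fun g hg hg1 => ?_) hg
  exact exists_abs_le_mul_slobodeckijReal (R := fun h => HasSecondVariation (menger p 2) γ h g)
    HasSecondVariation.const_smul_left HasSecondVariation.unique
    (fun h hh hh1 => exists_hasSecondVariation_menger_of_le_one hp hp' hγ hh hh1 hg hg1) hh

end Bound

end Menger

theorem theorem2p1 (n : ℕ) (p : ℝ) (hp : 7 / 3 < p) (hp' : p < 8 / 3) :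
    ∃ C₁ C₂ : ℝ → ℝ → ℝ, Menger.IsMonotoneConstant C₁ ∧ Menger.IsMonotoneConstant C₂ ∧
      ∀ γ : ℝ → EuclideanSpace ℝ (Fin n), Menger.MemWir (3 / 2 * p - 3) γ →
        (∀ h : ℝ → EuclideanSpace ℝ (Fin n), Menger.MemW (3 / 2 * p - 3) h →
          ∃ d : ℝ, Menger.HasFirstVariation (Menger.menger p 2) γ h d ∧
            |d| ≤ C₁ (Menger.biLip γ) (Menger.slobodeckijReal (3 / 2 * p - 3) (deriv γ)) *
              Menger.slobodeckijReal (3 / 2 * p - 3) (deriv h)) ∧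
        (∀ h g : ℝ → EuclideanSpace ℝ (Fin n),
          Menger.MemW (3 / 2 * p - 3) h → Menger.MemW (3 / 2 * p - 3) g →
          ∃ d : ℝ, Menger.HasSecondVariation (Menger.menger p 2) γ h g d ∧
            |d| ≤ C₂ (Menger.biLip γ) (Menger.slobodeckijReal (3 / 2 * p - 3) (deriv γ)) *
              Menger.slobodeckijReal (3 / 2 * p - 3) (deriv h) *
              Menger.slobodeckijReal (3 / 2 * p - 3) (deriv g)) := by
  have hp3 : p < 3 := by linarith
  refine ⟨Menger.firstVariationConst n p, Menger.secondVariationConst n p,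
    Menger.isMonotoneConstant_firstVariationConst n hp,
    Menger.isMonotoneConstant_secondVariationConst n hp, fun γ hγ => ⟨fun h hh => ?_,
    fun h g hh hg => ?_⟩⟩
  · exact Menger.exists_hasFirstVariation_menger hp hp3 hγ hh
  · exact Menger.exists_hasSecondVariation_menger hp hp3 hγ hh hg
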